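/- Let $\Omega\subset\mathbb{R}^2$ be a bounded domain, $T>0$, and let $D:\mathbb{R}^2\to M_{2\times 2}(\mathbb{R})$ be uniformly positive definite ($\xi^TD(z)\xi\ge\alpha|\xi|^2$ for all $z,\xi\in\mathbb{R}^2$, with some $\alpha>0$), Lipschitz continuous and bounded. Let $\mathbf{u}_0=(u_0,v_0)\in L^\infty(\Omega)^2$ with $u_0,v_0\ge 0$ a.e., and let $\mathbf{u}=(u,v)\in C([0,T];L^2(\Omega)^2)\cap L^2(0,T;H^1(\Omega)^2)$ be a weak solution of $\partial_t\mathbf{u}=\mathrm{div}(D(\mathbf{u})\nabla\mathbf{u})$ with homogeneous Neumann boundary conditions and $\mathbf{u}(0)=\mathbf{u}_0$, that is, for all $\mathbf{w}\in H^1(\Omega)^2$ (with $J$ denoting the Jacobian matrix), $$\int_\Omega \partial_t\mathbf{u}\cdot\mathbf{w}\,dx+\int_\Omega\mathrm{tr}\big((J\mathbf{w})^TD(\mathbf{u})J\mathbf{u}\big)\,dx=0 ,$$ where $\int_\Omega\partial_t\mathbf{u}\cdot\mathbf{w}\,dx$ is the duality pairing of $\partial_t\mathbf{u}\in L^2(0,T;(H^1(\Omega)^2)')$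 with $\mathbf{w}$. Put $a_1=\operatorname{ess\,inf}u_0$, $a_2=\operatorname{ess\,inf}v_0$, $b_1=\|u_0\|_{L^\infty}$, $b_2=\|v_0\|_{L^\infty}$, and let $K=[p_1,q_1]\times[p_2,q_2]$ with $p_j<q_j$, $p_j\le a_j$, $b_j\le q_j$ for $j=1,2$ (in particular $K=[a_1,b_1]\times[a_2,b_2]$ is allowed if $a_j<b_j$). Let $r\in C^2(K)$ (up to the boundary) be convex, and suppose that for every $t\in(0,T]$ and a.e. $x\in\Omega$ the value $\mathbf{u}(x,t)$ lies in $K$, where $r$ and its Hessian are defined, and $$\nabla^2r(\mathbf{u}(x,t))\,D(\mathbf{u}(x,t))=D(\mathbf{u}(x,t))\,\nabla^2r(\mathbf{u}(x,t)).$$ Then $V_r(t)=\Phi_r(\mathbf{u}(t))=\int_\Omega r(u(x,t),v(x,t))\,dx$ is a Lyapunov function: for every $t\in[0,T]$ the function $r(\mathbf{u}(\cdot,t))$ is integrable on $\Omega$, $V_r$ is continuous and nonincreasing on $[0,T]$, and $V_r(t)\ge\Phi_r(\mathbf{M}(\mathbf{u}_0))$ for all $t\in[0,T]$, where $\mathbf{M}(\mathbf{u}_0)=\frac{1}{|\Omega|}\int_\Omega\mathbf{u}_0\,dx$.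 -/

import Mathlib

open Set MeasureTheory
open scoped ContDiff Matrix

namespace CrossDiffusion

/-- The Euclidean plane, used both for points `x` of the image domain and for the values
`(u, v)` of a two-channel image. -/
abbrev Plane : Type := EuclideanSpace ℝ (Fin 2)

/-- `X₀ = L²(Ω) × L²(Ω)`, with norm `(‖u‖² + ‖v‖²)^{1/2}`. -/
abbrev X0 (Ω : Set Plane) : Type := Lp Plane 2 (volume.restrict Ω)

/-- `J 0 = w_x` and `J 1 = w_y` are the weak first partial derivatives in `L²` of `w` on `Ω`.
An element `w` of `X0 Ω` belongs to `X₁ = H¹(Ω) × H¹(Ω)` iff it has such a `J`. -/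
def HasWeakJacobian (Ω : Set Plane) (w : X0 Ω) (J : Fin 2 → X0 Ω) : Prop :=
  ∀ i j : Fin 2, ∀ φ : Plane → ℝ, ContDiff ℝ ∞ φ → HasCompactSupport φ → tsupport φ ⊆ Ω →
    ∫ x in Ω, w x i * fderiv ℝ φ x (EuclideanSpace.single j 1) = - ∫ x in Ω, J j x i * φ x

/-- The Jacobian matrix at the point `x`: entry `(i, j)` is `∂_j w_i (x)`. -/
noncomputable def jacobianAt {Ω : Set Plane} (J : Fin 2 → X0 Ω) (x : Plane) : Matrix (Fin 2) (Fin 2) ℝ :=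
  Matrix.of fun i j => J j x i

/-- The hypotheses on the cross-diffusion matrix: uniform positive definiteness, Lipschitz
continuity and boundedness of the entries. -/
structure IsDiffusionMatrix (D : Plane → Matrix (Fin 2) (Fin 2) ℝ) : Prop where
  posDef : ∃ α : ℝ, 0 < α ∧ ∀ (z : Plane) (ξ : Fin 2 → ℝ), α * (ξ ⬝ᵥ ξ) ≤ ξ ⬝ᵥ (D z *ᵥ ξ)
  lipschitz : ∃ L : ℝ, 0 < L ∧ ∀ (z z' : Plane) (i j : Fin 2), |D z' i j - D z i j| ≤ L * ‖z' - z‖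
  bounded : ∃ M : ℝ, 0 < M ∧ ∀ (z : Plane) (i j : Fin 2), |D z i j| ≤ M

/-- `∫_Ω tr((Jw)ᵀ D(u) Ju) dx`, where `J` and `Jw` are the Jacobians of `u` and `w`. -/
noncomputable def diffusionForm (Ω : Set Plane) (D : Plane → Matrix (Fin 2) (Fin 2) ℝ)
    (u : X0 Ω) (J Jw : Fin 2 → X0 Ω) : ℝ :=
  ∫ x in Ω, Matrix.trace ((jacobianAt Jw x)ᵀ * D (u x) * jacobianAt J x)

/-- Weak solutions on `[0, T]` of `∂ₜu = div (D(u) ∇u)` on `Ω` with homogeneous Neumann boundary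
condition and initial value `u₀`: `u ∈ C([0,T]; X₀) ∩ L²(0,T; X₁)`, `u(0) = u₀`, and
`⟨∂ₜu, w⟩ + ∫_Ω tr((Jw)ᵀ D(u) Ju) dx = 0` for all `w ∈ X₁`, where, as usual, the time
derivative `∂ₜu ∈ L²(0,T; X₁')` is expressed by integrating the equation over `[0, t]`. -/
structure IsWeakSolution (Ω : Set Plane) (D : Plane → Matrix (Fin 2) (Fin 2) ℝ) (T : ℝ)
    (u₀ : X0 Ω) (u : ℝ → X0 Ω) : Prop where
  continuousOn : ContinuousOn u (Icc 0 T)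
  initial : u 0 = u₀
  weak_form : ∃ J : ℝ → Fin 2 → X0 Ω,
    (∀ j, MemLp (fun t => J t j) 2 (volume.restrict (Ioc 0 T))) ∧
    (∀ᵐ t ∂(volume.restrict (Ioc 0 T)), HasWeakJacobian Ω (u t) (J t)) ∧
    ∀ (w : X0 Ω) (Jw : Fin 2 → X0 Ω), HasWeakJacobian Ω w Jw → ∀ t ∈ Icc 0 T,
      inner ℝ (u t) w - inner ℝ u₀ w + ∫ s in (0 : ℝ)..t, diffusionForm Ω D (u s) (J s) Jw = 0

/-- The lower extremum bounds `a_j = ess inf` of the channels of `w`. -/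
noncomputable def lowerBound {Ω : Set Plane} (w : X0 Ω) (j : Fin 2) : ℝ :=
  essInf (fun x => w x j) (volume.restrict Ω)

/-- The upper extremum bounds `b_j`, the `L^∞` norms of the channels of `w`. -/
noncomputable def upperBound {Ω : Set Plane} (w : X0 Ω) (j : Fin 2) : ℝ :=
  (eLpNorm (fun x => w x j) ⊤ (volume.restrict Ω)).toReal

/-- The closed box `[p₀, q₀] × [p₁, q₁]`. -/
def box (p q : Fin 2 → ℝ) : Set Plane := {z | ∀ j, p j ≤ z j ∧ z j ≤ q j}

/-- The Hessian matrix of `r` at `z`, for `r` twice differentiable on the set `K` (derivatives are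
taken within `K`, hence one-sided at boundary points of `K`). -/
noncomputable def hessian (K : Set Plane) (r : Plane → ℝ) (z : Plane) :
    Matrix (Fin 2) (Fin 2) ℝ :=
  Matrix.of fun i j => fderivWithin ℝ (fderivWithin ℝ r K) K z
    (EuclideanSpace.single i 1) (EuclideanSpace.single j 1)

/-- The functional `Φ_r(f) = ∫_Ω r(f(x)) dx`. -/
noncomputable def Phi (Ω : Set Plane) (r : Plane → ℝ) (f : Plane → Plane) : ℝ :=
  ∫ x in Ω, r (f x)

/-- The vector `M(w) = (m(w₀), m(w₁))` of the mean values of the channels of `w` on `Ω`. -/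
noncomputable def mean {Ω : Set Plane} (w : X0 Ω) : Plane :=
  WithLp.toLp 2 fun j => ⨍ x in Ω, w x j

end CrossDiffusion

open CrossDiffusion

/-! Formally, testing with `∇r(u)` gives `dV_r/dt = -∑_j ∫ (∇²r(u) ∂_j u) · (D(u) ∂_j u)`. The
integrand is nonnegative: a positive semidefinite `H` commuting with `D` has a square root commuting
with `D`, so `Hξ · Dξ = H^{1/2}ξ · D H^{1/2}ξ ≥ 0`.

The chain rule in time is avoided. Convexity bounds the backward increment `V_r(σ) - V_r(σ - h)` by
`⟨u(σ) - u(σ - h), ∇r(u(σ))⟩`. By the weak equation with the test function frozen at time `σ`, this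
pairing equals `-∫_{σ-h}^{σ} ⟨B σ, A s⟩ ds`, where `A = D(u) Ju` and `B = ∇²r(u) Ju` is the Jacobian
of `∇r(u)`. After integration in `σ` and division by `h`, continuity of translations in `L²`
replaces `A s` by `A σ` in the limit, and `⟨B σ, A σ⟩ ≥ 0` yields monotonicity
(`le_of_sub_le_neg_integral_inner`).

That `∇r(u(σ))` is an admissible test function is the `H¹` chain rule for functions that are `C¹`
only on the box (`hasWeakJacobian_comp`), proved by mollification: averages of values in a convex
set stay there. The lower bound is Jensen's inequality together with conservation of the mean,
obtained by testing with constants. -/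

/-! ### Monotonicity from backward increments and translations in `L²`. -/

open Filter Topology in
theorem tendsto_integral_inner_comp_sub {H : Type*} [NormedAddCommGroup H] [InnerProductSpace ℝ H]
    {A B : ℝ → H} (hA : MemLp A 2) (hB : MemLp B 2) :
    Tendsto (fun θ : ℝ => ∫ σ, inner ℝ (B σ) (A (σ - θ))) (𝓝 0)
      (𝓝 (∫ σ, inner ℝ (B σ) (A σ))) := by
  let g : C(ℝ, C(ℝ, ℝ)) := (ContinuousMap.mk (fun a : ℝ × ℝ ↦ a.2 - a.1) (by fun_prop)).curry
  have hg : ∀ θ, MeasurePreserving (g θ) volume volume := fun θ =>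
    measurePreserving_sub_right volume θ
  have key : ∀ θ, ∫ σ, inner ℝ (B σ) (A (σ - θ)) =
      inner ℝ (hB.toLp B) (Lp.compMeasurePreserving (g θ) (hg θ) (hA.toLp A)) := by
    intro θ
    rw [L2.inner_def]
    refine integral_congr_ae ?_
    filter_upwards [hB.coeFn_toLp, Lp.coeFn_compMeasurePreserving (hA.toLp A) (hg θ),
      (hg θ).quasiMeasurePreserving.ae_eq_comp hA.coeFn_toLp] with σ h1 h2 h3
    rw [h1, h2, h3]
    rfl
  have h0 : ∫ σ, inner ℝ (B σ) (A σ) = ∫ σ, inner ℝ (B σ) (A (σ - 0)) := by simp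
  rw [h0]
  simp_rw [key]
  refine Tendsto.inner tendsto_const_nhds ?_
  exact Filter.Tendsto.compMeasurePreservingLp tendsto_const_nhds (g.continuous.tendsto 0) hg
    (hg 0) (by norm_num)

/-- This licenses Fubini below. The integrand is bounded by `‖B‖² + ‖A‖²`; the shifted term is the
convolution integrand of an indicator with `‖A‖²`. -/
theorem integrable_inner_comp_sub_prod {H : Type*} [NormedAddCommGroup H] [InnerProductSpace ℝ H]
    {A B : ℝ → H} (hA : MemLp A 2) (hB : MemLp B 2) (a b c d : ℝ) :
    Integrable (fun z : ℝ × ℝ => inner ℝ (B z.1) (A (z.1 - z.2)))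
      ((volume.restrict (Ioc a b)).prod (volume.restrict (Ioc c d))) := by
  have hA2 : Integrable (fun s => ‖A s‖ ^ 2) := hA.integrable_norm_pow (by norm_num)
  have hB2 : Integrable (fun s => ‖B s‖ ^ 2) := hB.integrable_norm_pow (by norm_num)
  have h1 : Integrable (fun z : ℝ × ℝ => ‖B z.1‖ ^ 2)
      ((volume.restrict (Ioc a b)).prod (volume.restrict (Ioc c d))) :=
    (hB2.integrableOn (s := Ioc a b)).comp_fst _
  have h2 : Integrable (fun z : ℝ × ℝ => ‖A (z.1 - z.2)‖ ^ 2)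
      ((volume.restrict (Ioc a b)).prod (volume.restrict (Ioc c d))) := by
    have hf : Integrable (indicator (Ioc c d) (fun _ : ℝ => (1 : ℝ))) :=
      (integrable_indicator_iff measurableSet_Ioc).2 (by simp)
    have := (hf.convolution_integrand (ContinuousLinearMap.mul ℝ ℝ) hA2).integrableOn
      (s := Ioc a b ×ˢ Ioc c d)
    rw [Measure.prod_restrict]
    refine this.congr_fun ?_ (measurableSet_Ioc.prod measurableSet_Ioc)
    rintro ⟨x, y⟩ ⟨_, hy⟩
    simp only at hy
    simp [indicator_of_mem hy]
  refine Integrable.mono' (h1.add h2) ?_ (Filter.Eventually.of_forall fun z => ?_)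
  · refine AEStronglyMeasurable.inner ?_ ?_
    · exact (hB.1.restrict (s := Ioc a b)).comp_fst
    · have : AEStronglyMeasurable (fun z : ℝ × ℝ => A (z.1 - z.2)) (volume.prod volume) :=
        hA.1.comp_quasiMeasurePreserving (quasiMeasurePreserving_sub volume volume)
      rw [Measure.prod_restrict]
      exact this.restrict
  · have := norm_inner_le_norm (𝕜 := ℝ) (B z.1) (A (z.1 - z.2))
    simp only [Pi.add_apply]
    nlinarith [sq_nonneg (‖B z.1‖ - ‖A (z.1 - z.2)‖), sq_nonneg (‖B z.1‖),
      sq_nonneg ‖A (z.1 - z.2)‖]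

open Filter Topology in
/-- A continuous function whose backward increments are bounded by
`-∫ s in (σ - h)..σ, ⟪B σ, A s⟫` with `⟪B σ, A σ⟫ ≥ 0` almost everywhere is nonincreasing. -/
theorem le_of_sub_le_neg_integral_inner {H : Type*} [NormedAddCommGroup H]
    [InnerProductSpace ℝ H] {A B : ℝ → H} (hA : MemLp A 2) (hB : MemLp B 2) {φ : ℝ → ℝ}
    (hφ : Continuous φ) {T : ℝ}
    (hinc : ∀ᵐ σ, σ ∈ Ioc 0 T → ∀ h ∈ Ioo 0 σ,
      φ σ - φ (σ - h) ≤ -∫ s in (σ - h)..σ, inner ℝ (B σ) (A s))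
    (hpos : ∀ᵐ σ, σ ∈ Ioc 0 T → 0 ≤ inner ℝ (B σ) (A σ)) {t₁ t₂ : ℝ} (h0 : 0 < t₁)
    (h12 : t₁ ≤ t₂) (h2 : t₂ ≤ T) : φ t₂ ≤ φ t₁ := by
  refine le_of_forall_pos_le_add fun ε hε => ?_
  -- The cutoff turns integrals over the window into integrals over the line, where translation is
  -- an `L²` isometry.
  set B' : ℝ → H := indicator (Ioc t₁ t₂) B with hB'
  have hB'm : MemLp B' 2 := hB.indicator measurableSet_Ioc
  have hlim := tendsto_integral_inner_comp_sub hA hB'm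
  have hc0 : 0 ≤ ∫ σ, inner ℝ (B' σ) (A σ) := by
    refine integral_nonneg_of_ae ?_
    filter_upwards [hpos] with σ hσ
    by_cases hm : σ ∈ Ioc t₁ t₂
    · simpa [hB', indicator_of_mem hm] using hσ ⟨h0.trans hm.1, hm.2.trans h2⟩
    · simp [hB', indicator_of_notMem hm]
  -- One third of `ε` pays for the translation error, one for each endpoint average of `φ`.
  have ev1 : ∀ᶠ θ in 𝓝 (0 : ℝ), -(ε / 3) ≤ ∫ σ, inner ℝ (B' σ) (A (σ - θ)) :=
    hlim.eventually (Ici_mem_nhds (by linarith))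
  have ev2 : ∀ᶠ θ in 𝓝 (0 : ℝ), φ t₂ - ε / 3 ≤ φ (t₂ - θ) := by
    have : Tendsto (fun θ => φ (t₂ - θ)) (𝓝 0) (𝓝 (φ (t₂ - 0))) :=
      (by fun_prop : Continuous fun θ => φ (t₂ - θ)).tendsto 0
    exact this.eventually (Ici_mem_nhds (by simp; linarith))
  have ev3 : ∀ᶠ θ in 𝓝 (0 : ℝ), φ (t₁ - θ) ≤ φ t₁ + ε / 3 := by
    have : Tendsto (fun θ => φ (t₁ - θ)) (𝓝 0) (𝓝 (φ (t₁ - 0))) :=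
      (by fun_prop : Continuous fun θ => φ (t₁ - θ)).tendsto 0
    exact this.eventually (Iic_mem_nhds (by simp; linarith))
  obtain ⟨δ, hδ, hball⟩ := Metric.eventually_nhds_iff.1 (ev1.and (ev2.and ev3))
  obtain ⟨h, hh0, hh⟩ : ∃ h, 0 < h ∧ h < min δ t₁ := exists_between (lt_min hδ h0)
  have hhδ := hh.trans_le (min_le_left _ _)
  have hht := hh.trans_le (min_le_right _ _)
  have hsmall : ∀ θ ∈ Icc 0 h, dist θ 0 < δ := fun θ hθ => by
    rw [Real.dist_0_eq_abs, abs_of_nonneg hθ.1]; exact hθ.2.trans_lt hhδ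
  have hint := integrable_inner_comp_sub_prod hA hB t₁ t₂ 0 h
  have hshift : ∀ σ, ∫ s in (σ - h)..σ, inner ℝ (B σ) (A s) =
      ∫ θ in Ioc 0 h, inner ℝ (B σ) (A (σ - θ)) := by
    intro σ
    rw [← intervalIntegral.integral_of_le hh0.le,
      intervalIntegral.integral_comp_sub_left (fun s => inner ℝ (B σ) (A s)) σ, sub_zero]
  have hfub : ∫ σ in Ioc t₁ t₂, ∫ θ in Ioc 0 h, inner ℝ (B σ) (A (σ - θ)) =
      ∫ θ in Ioc 0 h, ∫ σ, inner ℝ (B' σ) (A (σ - θ)) := by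
    rw [integral_integral_swap (f := fun σ θ => inner ℝ (B σ) (A (σ - θ))) hint]
    congr 1
    ext θ
    rw [← integral_indicator measurableSet_Ioc]
    congr 1
    ext σ
    by_cases hm : σ ∈ Ioc t₁ t₂
    · simp [hB', indicator_of_mem hm]
    · simp [hB', indicator_of_notMem hm]
  have hlow : -(ε / 3) * h ≤ ∫ θ in Ioc 0 h, ∫ σ, inner ℝ (B' σ) (A (σ - θ)) := by
    have hi : IntegrableOn (fun θ => ∫ σ, inner ℝ (B' σ) (A (σ - θ))) (Ioc 0 h) := by
      have := hint.integral_prod_right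
      refine this.congr (Eventually.of_forall fun θ => ?_)
      simp only
      rw [← integral_indicator measurableSet_Ioc]
      congr 1
      ext σ
      by_cases hm : σ ∈ Ioc t₁ t₂
      · simp [hB', indicator_of_mem hm]
      · simp [hB', indicator_of_notMem hm]
    have : ∫ θ in Ioc 0 h, (-(ε / 3)) ≤ ∫ θ in Ioc 0 h, ∫ σ, inner ℝ (B' σ) (A (σ - θ)) :=
      setIntegral_mono_on (by simp) hi measurableSet_Ioc
        fun θ hθ => (hball (hsmall θ ⟨hθ.1.le, hθ.2⟩)).1
    refine le_trans (le_of_eq ?_) this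
    simp [hh0.le]; ring
  have hφi : ∀ a b, IntervalIntegrable φ volume a b := fun a b => hφ.intervalIntegrable a b
  have hmain : ∫ σ in t₁..t₂, (φ σ - φ (σ - h)) ≤
      -∫ σ in Ioc t₁ t₂, ∫ θ in Ioc 0 h, inner ℝ (B σ) (A (σ - θ)) := by
    rw [intervalIntegral.integral_of_le h12, ← integral_neg]
    refine integral_mono_ae ?_ hint.integral_prod_left.neg ?_
    · exact ((by fun_prop : Continuous fun σ => φ σ - φ (σ - h)).intervalIntegrable t₁ t₂).1
    · rw [EventuallyLE, ae_restrict_iff' measurableSet_Ioc]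
      filter_upwards [hinc] with σ hσ hm
      rw [← hshift]
      exact hσ ⟨h0.trans hm.1, hm.2.trans h2⟩ h ⟨hh0, hht.trans hm.1⟩
  -- Shifted windows cancel, leaving only averages over intervals of length `h` ending at `t₂` and
  -- `t₁`.
  have hL : ∫ σ in t₁..t₂, (φ σ - φ (σ - h)) =
      (∫ σ in (t₂ - h)..t₂, φ σ) - ∫ σ in (t₁ - h)..t₁, φ σ := by
    rw [intervalIntegral.integral_sub (hφi _ _)
      ((by fun_prop : Continuous fun σ => φ (σ - h)).intervalIntegrable _ _),
      intervalIntegral.integral_comp_sub_right]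
    have e1 := intervalIntegral.integral_add_adjacent_intervals (hφi (t₁ - h) t₁) (hφi t₁ t₂)
    have e2 := intervalIntegral.integral_add_adjacent_intervals (hφi (t₁ - h) (t₂ - h))
      (hφi (t₂ - h) t₂)
    linarith
  have hb2 : (φ t₂ - ε / 3) * h ≤ ∫ σ in (t₂ - h)..t₂, φ σ := by
    have : ∫ σ in (t₂ - h)..t₂, (φ t₂ - ε / 3) ≤ ∫ σ in (t₂ - h)..t₂, φ σ := by
      refine intervalIntegral.integral_mono_on (by linarith) (by simp) (hφi _ _) fun σ hσ => ?_
      have := (hball (hsmall (t₂ - σ) ⟨by linarith [hσ.2], by linarith [hσ.1]⟩)).2.1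
      simpa using this
    refine le_trans (le_of_eq ?_) this
    simp; ring
  have hb1 : ∫ σ in (t₁ - h)..t₁, φ σ ≤ (φ t₁ + ε / 3) * h := by
    have : ∫ σ in (t₁ - h)..t₁, φ σ ≤ ∫ σ in (t₁ - h)..t₁, (φ t₁ + ε / 3) := by
      refine intervalIntegral.integral_mono_on (by linarith) (hφi _ _) (by simp) fun σ hσ => ?_
      have := (hball (hsmall (t₁ - σ) ⟨by linarith [hσ.2], by linarith [hσ.1]⟩)).2.2
      simpa using this
    refine this.trans (le_of_eq ?_)
    simp; ring
  rw [hfub] at hmain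
  have : h * (φ t₂ - φ t₁ - ε) ≤ 0 := by nlinarith
  nlinarith [nonpos_of_mul_nonpos_right this hh0]

open Filter Topology in
-- The backward shift needs room to the left of `t₁`, so the case `t₁ = 0` is recovered by
-- continuity from `s ↓ 0`.
theorem antitoneOn_of_sub_le_neg_integral_inner {H : Type*} [NormedAddCommGroup H]
    [InnerProductSpace ℝ H] {A B : ℝ → H} (hA : MemLp A 2) (hB : MemLp B 2) {φ : ℝ → ℝ} {T : ℝ}
    (hT : 0 < T) (hφ : ContinuousOn φ (Icc 0 T))
    (hinc : ∀ᵐ σ, σ ∈ Ioc 0 T → ∀ h ∈ Ioo 0 σ,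
      φ σ - φ (σ - h) ≤ -∫ s in (σ - h)..σ, inner ℝ (B σ) (A s))
    (hpos : ∀ᵐ σ, σ ∈ Ioc 0 T → 0 ≤ inner ℝ (B σ) (A σ)) : AntitoneOn φ (Icc 0 T) := by
  set ψ : ℝ → ℝ := IccExtend hT.le (fun t => φ t) with hψ
  have hψc : Continuous ψ := hφ.domRestrict.Icc_extend'
  have heq : ∀ t ∈ Icc 0 T, ψ t = φ t := fun t ht => by rw [hψ, IccExtend_of_mem _ _ ht]
  have hmono : ∀ t₁ t₂, 0 < t₁ → t₁ ≤ t₂ → t₂ ≤ T → ψ t₂ ≤ ψ t₁ := by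
    intro t₁ t₂ h0 h12 h2
    refine le_of_sub_le_neg_integral_inner hA hB hψc ?_ hpos h0 h12 h2
    filter_upwards [hinc] with σ hσ hm h hh
    rw [heq σ ⟨hm.1.le, hm.2⟩, heq (σ - h) ⟨by linarith [hh.2], by linarith [hh.1, hm.2]⟩]
    exact hσ hm h hh
  intro t₁ ht₁ t₂ ht₂ h12
  change φ t₂ ≤ φ t₁
  rw [← heq _ ht₁, ← heq _ ht₂]
  rcases ht₁.1.eq_or_lt with h0 | h0
  · rcases h12.eq_or_lt with h | h
    · rw [h]
    · rw [← h0] at h ⊢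
      have hlim : Tendsto ψ (𝓝[>] 0) (𝓝 (ψ 0)) := hψc.continuousWithinAt.tendsto
      refine ge_of_tendsto hlim ?_
      filter_upwards [Ioo_mem_nhdsGT h] with s hs
      exact hmono s t₂ hs.1 hs.2.le ht₂.2
  · exact hmono t₁ t₂ h0 h12 ht₂.2

/-! ### Multiplication by bounded continuous coefficients on `L²`. -/

section MulLp

open Filter Topology

variable {α E F : Type*} [MeasurableSpace α] {μ : Measure α} [NormedAddCommGroup E]
  [NormedAddCommGroup F] [InnerProductSpace ℝ F]

theorem memLp_clm_apply {M : E → F →L[ℝ] F} (hM : Continuous M) {C : ℝ} (hC : ∀ z, ‖M z‖ ≤ C)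
    (u : Lp E 2 μ) (f : Lp F 2 μ) : MemLp (fun x => M (u x) (f x)) 2 μ := by
  refine (Lp.memLp f).of_le_mul (c := C) ?_ (Eventually.of_forall fun x => ?_)
  · exact isBoundedBilinearMap_apply.continuous.comp_aestronglyMeasurable
      ((hM.comp_aestronglyMeasurable (Lp.aestronglyMeasurable u)).prodMk
        (Lp.aestronglyMeasurable f))
  · exact ((M (u x)).le_opNorm _).trans (by gcongr; exact hC _)

/-- The `L²` function `x ↦ M (u x) (f x)` for a bounded continuous operator-valued `M`. -/
noncomputable def mulLp {M : E → F →L[ℝ] F} (hM : Continuous M) {C : ℝ} (hC : ∀ z, ‖M z‖ ≤ C)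
    (u : Lp E 2 μ) (f : Lp F 2 μ) : Lp F 2 μ :=
  (memLp_clm_apply hM hC u f).toLp _

variable {M : E → F →L[ℝ] F} (hM : Continuous M) {C : ℝ} (hC : ∀ z, ‖M z‖ ≤ C)

theorem coeFn_mulLp (u : Lp E 2 μ) (f : Lp F 2 μ) :
    mulLp hM hC u f =ᵐ[μ] fun x => M (u x) (f x) :=
  MemLp.coeFn_toLp _

theorem norm_mulLp_le (u : Lp E 2 μ) (f : Lp F 2 μ) : ‖mulLp hM hC u f‖ ≤ C * ‖f‖ := by
  refine Lp.norm_le_mul_norm_of_ae_le_mul ?_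
  filter_upwards [coeFn_mulLp hM hC u f] with x hx
  rw [hx]
  exact ((M (u x)).le_opNorm _).trans (by gcongr; exact hC _)

theorem mulLp_sub (u : Lp E 2 μ) (f g : Lp F 2 μ) :
    mulLp hM hC u (f - g) = mulLp hM hC u f - mulLp hM hC u g := by
  ext1
  filter_upwards [coeFn_mulLp hM hC u f, coeFn_mulLp hM hC u g, coeFn_mulLp hM hC u (f - g),
    Lp.coeFn_sub f g, Lp.coeFn_sub (mulLp hM hC u f) (mulLp hM hC u g)] with x h1 h2 h3 h4 h5
  rw [h3, h5, Pi.sub_apply, h1, h2, h4, Pi.sub_apply, map_sub]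

theorem L2_norm_sq_eq_integral (f : Lp F 2 μ) : ‖f‖ ^ 2 = ∫ x, ‖f x‖ ^ 2 ∂μ := by
  rw [← real_inner_self_eq_norm_sq, L2.inner_def]
  simp_rw [real_inner_self_eq_norm_sq]

theorem tendsto_mulLp_of_tendsto_ae {u : ℕ → Lp E 2 μ} {v : Lp E 2 μ} (f : Lp F 2 μ)
    (h : ∀ᵐ x ∂μ, Tendsto (fun n => u n x) atTop (𝓝 (v x))) :
    Tendsto (fun n => mulLp hM hC (u n) f) atTop (𝓝 (mulLp hM hC v f)) := by
  rw [tendsto_iff_norm_sub_tendsto_zero]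
  have hae : ∀ n, ∀ᵐ x ∂μ, (mulLp hM hC (u n) f - mulLp hM hC v f) x =
      M (u n x) (f x) - M (v x) (f x) := fun n => by
    filter_upwards [coeFn_mulLp hM hC (u n) f, coeFn_mulLp hM hC v f,
      Lp.coeFn_sub (mulLp hM hC (u n) f) (mulLp hM hC v f)] with x h1 h2 h3
    rw [h3, Pi.sub_apply, h1, h2]
  have hsq : Tendsto (fun n => ‖mulLp hM hC (u n) f - mulLp hM hC v f‖ ^ 2) atTop (𝓝 0) := by
    simp_rw [L2_norm_sq_eq_integral]
    have h0 : (0 : ℝ) = ∫ _, (0 : ℝ) ∂μ := by simp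
    rw [h0]
    refine tendsto_integral_of_dominated_convergence (fun x => (2 * C) ^ 2 * ‖f x‖ ^ 2) ?_ ?_ ?_ ?_
    · exact fun n => ((Lp.aestronglyMeasurable _).norm.pow 2)
    · exact ((Lp.memLp f).integrable_norm_pow (by norm_num)).const_mul _
    · intro n
      filter_upwards [hae n] with x hx
      rw [hx, Real.norm_of_nonneg (by positivity), ← mul_pow]
      refine pow_le_pow_left₀ (norm_nonneg _) ?_ 2
      calc ‖M (u n x) (f x) - M (v x) (f x)‖ ≤ ‖M (u n x) (f x)‖ + ‖M (v x) (f x)‖ :=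
            norm_sub_le _ _
        _ ≤ C * ‖f x‖ + C * ‖f x‖ :=
            add_le_add ((M (u n x)).le_of_opNorm_le (hC _) _) ((M (v x)).le_of_opNorm_le (hC _) _)
        _ = 2 * C * ‖f x‖ := by ring
    · filter_upwards [h, ae_all_iff.2 hae] with x hx hx2
      simp_rw [hx2]
      have h1 : Tendsto (fun n => M (u n x)) atTop (𝓝 (M (v x))) := (hM.tendsto _).comp hx
      have := (((ContinuousLinearMap.apply ℝ F (f x)).continuous.tendsto _).comp h1).sub_const (M (v x) (f x))
      simpa using (this.norm.pow 2)
  have := hsq.sqrt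
  simpa using this

/-- Split `M(uₙ)fₙ = M(uₙ)(fₙ - f) + M(uₙ)f`. The first term is at most `C‖fₙ - f‖`; for the second,
every subsequence has a further one along which `uₙ` converges almost everywhere, and dominated
convergence applies. -/
theorem continuous_mulLp : Continuous fun z : Lp E 2 μ × Lp F 2 μ => mulLp hM hC z.1 z.2 := by
  rw [continuous_iff_seqContinuous]
  intro z w hz
  have hz1 : Tendsto (fun n => (z n).1) atTop (𝓝 w.1) := (continuous_fst.tendsto _).comp hz
  have hz2 : Tendsto (fun n => (z n).2) atTop (𝓝 w.2) := (continuous_snd.tendsto _).comp hz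
  have hfix : Tendsto (fun n => mulLp hM hC (z n).1 w.2) atTop (𝓝 (mulLp hM hC w.1 w.2)) := by
    refine tendsto_of_subseq_tendsto fun ns hns => ?_
    obtain ⟨ms, -, hms⟩ := (tendstoInMeasure_of_tendsto_Lp (hz1.comp hns)).exists_seq_tendsto_ae
    exact ⟨ms, tendsto_mulLp_of_tendsto_ae hM hC w.2 hms⟩
  have hdiff : Tendsto (fun n => mulLp hM hC (z n).1 ((z n).2 - w.2)) atTop (𝓝 0) := by
    refine squeeze_zero_norm (fun n => norm_mulLp_le hM hC _ _) ?_
    have : Tendsto (fun n => C * ‖(z n).2 - w.2‖) atTop (𝓝 (C * 0)) :=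
      (tendsto_iff_norm_sub_tendsto_zero.1 hz2).const_mul C
    simpa using this
  have := hdiff.add hfix
  simp only [mulLp_sub, sub_add_cancel, zero_add] at this
  exact this

end MulLp

open Filter Topology in
/-- Dominated convergence with bounds that converge along with their integrals. -/
theorem tendsto_integral_of_dominated_of_tendsto_integral {α : Type*} [MeasurableSpace α]
    {μ : Measure α} {F g : ℕ → α → ℝ} {f G : α → ℝ}
    (hF : ∀ n, AEStronglyMeasurable (F n) μ) (hg : ∀ n, Integrable (g n) μ) (hG : Integrable G μ)
    (hle : ∀ n, ∀ᵐ x ∂μ, |F n x| ≤ g n x)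
    (hFlim : ∀ᵐ x ∂μ, Tendsto (fun n => F n x) atTop (𝓝 (f x)))
    (hglim : ∀ᵐ x ∂μ, Tendsto (fun n => g n x) atTop (𝓝 (G x)))
    (hint : Tendsto (fun n => ∫ x, g n x ∂μ) atTop (𝓝 (∫ x, G x ∂μ))) :
    Tendsto (fun n => ∫ x, F n x ∂μ) atTop (𝓝 (∫ x, f x ∂μ)) := by
  have hfm : AEStronglyMeasurable f μ := aestronglyMeasurable_of_tendsto_ae atTop hF hFlim
  have hfle : ∀ᵐ x ∂μ, |f x| ≤ G x := by
    filter_upwards [hFlim, hglim, ae_all_iff.2 hle] with x h1 h2 h3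
    exact le_of_tendsto_of_tendsto' h1.abs h2 h3
  have hfi : Integrable f μ := hG.mono' hfm hfle
  have hFi : ∀ n, Integrable (F n) μ := fun n => (hg n).mono' (hF n) (hle n)
  -- Truncating at `2 * G` gives a fixed majorant, so ordinary dominated convergence plays the role
  -- of Fatou's lemma.
  have hmin : Tendsto (fun n => ∫ x, min (g n x + G x - |F n x - f x|) (2 * G x) ∂μ) atTop
      (𝓝 (∫ x, 2 * G x ∂μ)) := by
    refine tendsto_integral_of_dominated_convergence (fun x => 2 * G x) ?_ (hG.const_mul 2) ?_ ?_
    · intro n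
      exact ((((hg n).add hG).sub ((hFi n).sub hfi).abs).inf (hG.const_mul 2)).1
    · intro n
      filter_upwards [hle n, hfle] with x h1 h2
      have := abs_sub (F n x) (f x)
      have h3 := abs_nonneg (f x)
      rw [Real.norm_of_nonneg (le_min (by linarith) (by linarith))]
      exact min_le_right _ _
    · filter_upwards [hFlim, hglim] with x h1 h2
      have : Tendsto (fun n => min (g n x + G x - |F n x - f x|) (2 * G x)) atTop
          (𝓝 (min (G x + G x - |f x - f x|) (2 * G x))) :=
        ((h2.add_const _).sub (h1.sub_const _).abs).min tendsto_const_nhds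
      have e : min (G x + G x - |f x - f x|) (2 * G x) = 2 * G x := by
        rw [sub_self, abs_zero, sub_zero, two_mul, min_self]
      rwa [e] at this
  rw [tendsto_iff_norm_sub_tendsto_zero]
  have hup : Tendsto (fun n => (∫ x, g n x ∂μ) + (∫ x, G x ∂μ) -
      ∫ x, min (g n x + G x - |F n x - f x|) (2 * G x) ∂μ) atTop (𝓝 0) := by
    have := (hint.add_const (∫ x, G x ∂μ)).sub hmin
    rw [integral_const_mul] at this
    convert this using 2
    ring
  refine squeeze_zero (fun n => norm_nonneg _) (fun n => ?_) hup
  have hi := (((hg n).add hG).sub ((hFi n).sub hfi).abs)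
  have h1 : ∫ x, min (g n x + G x - |F n x - f x|) (2 * G x) ∂μ ≤
      ∫ x, (g n x + G x - |F n x - f x|) ∂μ :=
    integral_mono (hi.inf (hG.const_mul 2)) hi fun x => min_le_left _ _
  have h2 : ∫ x, (g n x + G x - |F n x - f x|) ∂μ =
      (∫ x, g n x ∂μ) + (∫ x, G x ∂μ) - ∫ x, |F n x - f x| ∂μ := by
    rw [← integral_add (hg n) hG]
    exact integral_sub ((hg n).add hG) ((hFi n).sub hfi).abs
  rw [← integral_sub (hFi n) hfi]
  have h3 := norm_integral_le_integral_norm (μ := μ) (fun x => F n x - f x)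
  simp only [Real.norm_eq_abs] at h3 ⊢
  linarith

/-! ### Positivity for commuting matrices. -/

section Matrix

/-- `D` need not be symmetric, so the root of `H` is moved across it. By Cayley–Hamilton that root
is `(H + δ) / √(tr H + 2δ)` with `δ = √(det H)`. Clearing the denominator leaves a polynomial
identity, and the denominator vanishes only if `H = 0`. -/
theorem Matrix.PosSemidef.dotProduct_mul_mulVec_nonneg_of_commute
    {H D : Matrix (Fin 2) (Fin 2) ℝ} (hH : H.PosSemidef) (hHD : H * D = D * H)
    (hD : ∀ ξ : Fin 2 → ℝ, 0 ≤ ξ ⬝ᵥ (D *ᵥ ξ)) (ξ : Fin 2 → ℝ) :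
    0 ≤ (H *ᵥ ξ) ⬝ᵥ (D *ᵥ ξ) := by
  have hsymm : H 1 0 = H 0 1 := by simpa using hH.1.apply 0 1
  have htr : 0 ≤ H 0 0 + H 1 1 := add_nonneg hH.diag_nonneg hH.diag_nonneg
  have hdet : 0 ≤ H 0 0 * H 1 1 - H 0 1 * H 0 1 := by
    have := hH.det_nonneg
    rwa [Matrix.det_fin_two, hsymm] at this
  obtain ⟨δ, hδ0, hδ⟩ : ∃ δ : ℝ, 0 ≤ δ ∧ δ * δ = H 0 0 * H 1 1 - H 0 1 * H 0 1 :=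
    ⟨_, Real.sqrt_nonneg _, Real.mul_self_sqrt hdet⟩
  have e00 := congr_fun (congr_fun hHD 0) 0
  have e01 := congr_fun (congr_fun hHD 0) 1
  have e10 := congr_fun (congr_fun hHD 1) 0
  have e11 := congr_fun (congr_fun hHD 1) 1
  simp only [Matrix.mul_apply, Fin.sum_univ_two, hsymm] at e00 e01 e10 e11
  -- `H + δ` commutes with `D` and `(H + δ)² = (tr H + 2 δ) H`
  have key : (H 0 0 + H 1 1 + 2 * δ) * ((H *ᵥ ξ) ⬝ᵥ (D *ᵥ ξ)) =
      (((H + δ • 1) *ᵥ ξ)) ⬝ᵥ (D *ᵥ ((H + δ • 1) *ᵥ ξ)) := by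
    simp only [Matrix.mulVec, dotProduct, Fin.sum_univ_two, Matrix.add_apply, Matrix.smul_apply,
      Matrix.one_apply_eq, Matrix.one_apply_ne (zero_ne_one' (Fin 2)),
      Matrix.one_apply_ne (zero_ne_one' (Fin 2)).symm, smul_eq_mul, mul_one, mul_zero, add_zero,
      hsymm]
    linear_combination
      -(ξ 0 * (D 0 0 * ξ 0 + D 0 1 * ξ 1) + ξ 1 * (D 1 0 * ξ 0 + D 1 1 * ξ 1)) * hδ +
      ((H 0 0 + δ) * ξ 0 + H 0 1 * ξ 1) * ξ 0 * e00 + ((H 0 0 + δ) * ξ 0 + H 0 1 * ξ 1) * ξ 1 * e01 +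
      (H 0 1 * ξ 0 + (H 1 1 + δ) * ξ 1) * ξ 0 * e10 + (H 0 1 * ξ 0 + (H 1 1 + δ) * ξ 1) * ξ 1 * e11
  have hpos := hD ((H + δ • 1) *ᵥ ξ)
  rw [← key] at hpos
  rcases (by positivity : 0 ≤ H 0 0 + H 1 1 + 2 * δ).eq_or_lt with h0 | h0
  · have h00 : (0 : ℝ) ≤ H 0 0 := hH.diag_nonneg
    have h11 : (0 : ℝ) ≤ H 1 1 := hH.diag_nonneg
    have z0 : H 0 0 = 0 := by linarith
    have z1 : H 1 1 = 0 := by linarith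
    have z2 : δ = 0 := by linarith
    have z01 : H 0 1 = 0 := by
      rw [z0, z2] at hδ
      exact mul_self_eq_zero.1 (by linarith)
    have : H = 0 := by
      ext i j
      fin_cases i <;> fin_cases j <;> simp [z0, z1, z01, hsymm]
    simp [this]
  · exact nonneg_of_mul_nonneg_right (by linarith) h0

end Matrix

/-! ### First and second order conditions for convexity, up to the boundary. -/

section Convex

open Filter Topology

variable {E : Type*} [NormedAddCommGroup E] [NormedSpace ℝ E] {K : Set E} {r : E → ℝ}

/-- On the segment from `a` to `b` the secant slope dominates the one-sided derivative at `a`, so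
`a` may lie on the boundary. -/
theorem ConvexOn.sub_le_fderivWithin (hr : ConvexOn ℝ K r) {a b : E} (ha : a ∈ K) (hb : b ∈ K)
    (hd : DifferentiableWithinAt ℝ r K a) : r a - r b ≤ fderivWithin ℝ r K a (a - b) := by
  set l : ℝ → E := fun s => AffineMap.lineMap a b s with hl
  have hmaps : MapsTo l (Icc 0 1) K := fun s hs => hr.1.lineMap_mem ha hb hs
  have hconv : ConvexOn ℝ (Icc (0 : ℝ) 1) (r ∘ l) :=
    (hr.comp_affineMap (AffineMap.lineMap a b)).subset hmaps (convex_Icc 0 1)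
  have hl0 : l 0 = a := by simp [hl]
  have hl1 : l 1 = b := by simp [hl]
  have hld : HasDerivWithinAt l (b - a) (Icc 0 1) 0 := by
    simpa [hl] using (AffineMap.hasDerivWithinAt_lineMap (a := a) (b := b) (s := Icc (0:ℝ) 1) (x := 0))
  have hder : HasDerivWithinAt (r ∘ l) (fderivWithin ℝ r K a (b - a)) (Icc 0 1) 0 := by
    have h1 : HasFDerivWithinAt r (fderivWithin ℝ r K a) K (l 0) := by
      rw [hl0]; exact hd.hasFDerivWithinAt
    exact h1.comp_hasDerivWithinAt 0 hld hmaps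
  have := hconv.le_slope_of_hasDerivWithinAt (x := 0) (y := 1) (by simp) (by simp) one_pos hder
  rw [slope_def_field] at this
  simp only [Function.comp_apply, hl0, hl1, sub_zero, div_one] at this
  rw [← neg_sub b a, map_neg]
  linarith

/-- Adding the tangent inequalities at `z` and `z + s • v` shows that the derivative is monotone
along `v`; its difference quotients are therefore nonnegative. -/
theorem ConvexOn.fderivWithin_fderivWithin_nonneg_of_mem_interior (hr : ConvexOn ℝ K r)
    (hK : UniqueDiffOn ℝ K) (hd : ContDiffOn ℝ 2 r K) {z : E} (hz : z ∈ interior K) (v : E) :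
    0 ≤ fderivWithin ℝ (fderivWithin ℝ r K) K z v v := by
  have hKz : K ∈ 𝓝 z := mem_interior_iff_mem_nhds.1 hz
  have hzK := interior_subset hz
  have hd1 : ContDiffOn ℝ 1 (fderivWithin ℝ r K) K := hd.fderivWithin hK (by norm_num)
  have h1 : HasFDerivAt (fderivWithin ℝ r K) (fderivWithin ℝ (fderivWithin ℝ r K) K z) z :=
    ((hd1.differentiableOn one_ne_zero) z hzK).hasFDerivWithinAt.hasFDerivAt hKz
  have hl : HasDerivAt (fun s : ℝ => z + s • v) v 0 := by
    simpa using ((hasDerivAt_id (0 : ℝ)).smul_const v).const_add z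
  have h2 : HasDerivAt (fun s : ℝ => fderivWithin ℝ r K (z + s • v) v)
      (fderivWithin ℝ (fderivWithin ℝ r K) K z v v) 0 := by
    have h3 : HasDerivAt (fun s : ℝ => fderivWithin ℝ r K (z + s • v))
        (fderivWithin ℝ (fderivWithin ℝ r K) K z v) 0 := by
      refine HasFDerivAt.comp_hasDerivAt (x := (0 : ℝ)) (l := fderivWithin ℝ r K) ?_ hl
      simpa using h1
    exact ((ContinuousLinearMap.apply ℝ ℝ v).hasFDerivAt).comp_hasDerivAt 0 h3
  rw [hasDerivAt_iff_tendsto_slope_zero] at h2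
  refine ge_of_tendsto h2 ?_
  have hmem : ∀ᶠ s : ℝ in 𝓝[≠] 0, z + s • v ∈ K := by
    have : Tendsto (fun s : ℝ => z + s • v) (𝓝[≠] 0) (𝓝 z) := by
      have := (hl.continuousAt.tendsto).mono_left (nhdsWithin_le_nhds (s := {0}ᶜ))
      simpa using this
    exact this hKz
  filter_upwards [hmem, self_mem_nhdsWithin] with s hs hs0
  have hdiff := hd.differentiableOn two_ne_zero
  have i1 := hr.sub_le_fderivWithin hs hzK (hdiff _ hs)
  have i2 := hr.sub_le_fderivWithin hzK hs (hdiff _ hzK)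
  have e1 : z + s • v - z = s • v := by abel
  have e2 : z - (z + s • v) = -(s • v) := by abel
  rw [e1, map_smul, smul_eq_mul] at i1
  rw [e2, map_neg, map_smul, smul_eq_mul] at i2
  have hprod : 0 ≤ s * (fderivWithin ℝ r K (z + s • v) v - fderivWithin ℝ r K z v) := by linarith
  have hs2 : 0 < s ^ 2 := by
    have : s ≠ 0 := hs0
    positivity
  simp only [zero_add, zero_smul, add_zero, smul_eq_mul]
  have : s⁻¹ * (fderivWithin ℝ r K (z + s • v) v - fderivWithin ℝ r K z v) =
      (s * (fderivWithin ℝ r K (z + s • v) v - fderivWithin ℝ r K z v)) / s ^ 2 := by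
    have : s ≠ 0 := hs0
    field_simp
  rw [this]
  positivity

theorem ConvexOn.fderivWithin_fderivWithin_nonneg (hr : ConvexOn ℝ K r)
    (hK : UniqueDiffOn ℝ K) (hcl : K ⊆ closure (interior K)) (hd : ContDiffOn ℝ 2 r K) {z : E}
    (hz : z ∈ K) (v : E) : 0 ≤ fderivWithin ℝ (fderivWithin ℝ r K) K z v v := by
  have hd1 : ContDiffOn ℝ 1 (fderivWithin ℝ r K) K := hd.fderivWithin hK (by norm_num)
  have hcont : ContinuousOn (fun z => fderivWithin ℝ (fderivWithin ℝ r K) K z v v) K :=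
    ((hd1.continuousOn_fderivWithin hK le_rfl).clm_apply continuousOn_const).clm_apply
      continuousOn_const
  have hmem := hcont.continuousWithinAt hz |>.mono interior_subset
  have : (𝓝[interior K] z).NeBot := mem_closure_iff_nhdsWithin_neBot.1 (hcl hz)
  refine ge_of_tendsto hmem.tendsto ?_
  filter_upwards [self_mem_nhdsWithin] with y hy
  exact hr.fderivWithin_fderivWithin_nonneg_of_mem_interior hK hd hy v

end Convex

/-! ### Boxes of values and the retraction onto them. -/

namespace CrossDiffusion

open Filter Topology

theorem convex_box (p q : Fin 2 → ℝ) : Convex ℝ (box p q) := by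
  intro x hx y hy a b ha hb hab j
  have h1 := hx j
  have h2 := hy j
  simp only [PiLp.add_apply, PiLp.smul_apply, smul_eq_mul]
  have : b = 1 - a := by linarith
  subst this
  constructor <;> nlinarith

theorem isClosed_box (p q : Fin 2 → ℝ) : IsClosed (box p q) := by
  have : box p q = ⋂ j, {z : Plane | p j ≤ z j} ∩ {z : Plane | z j ≤ q j} := by
    ext z; simp [box]
  rw [this]
  exact isClosed_iInter fun j => (isClosed_le (by fun_prop) (by fun_prop)).inter
    (isClosed_le (by fun_prop) (by fun_prop))

theorem isCompact_box (p q : Fin 2 → ℝ) : IsCompact (box p q) := by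
  have h : box p q ⊆ WithLp.toLp 2 '' (Set.Icc p q) := fun z hz =>
    ⟨z.ofLp, ⟨fun j => (hz j).1, fun j => (hz j).2⟩, rfl⟩
  exact (isCompact_Icc.image (PiLp.continuous_toLp 2 _)).of_isClosed_subset (isClosed_box p q) h

theorem nonempty_interior_box {p q : Fin 2 → ℝ} (hpq : ∀ j, p j < q j) :
    (interior (box p q)).Nonempty := by
  refine ⟨WithLp.toLp 2 fun j => (p j + q j) / 2, ?_⟩
  refine mem_interior.2 ⟨{z : Plane | ∀ j, p j < z j ∧ z j < q j}, fun z hz j =>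
    ⟨(hz j).1.le, (hz j).2.le⟩, ?_, fun j => ⟨?_, ?_⟩⟩
  · have : {z : Plane | ∀ j, p j < z j ∧ z j < q j} =
        ⋂ j, {z : Plane | p j < z j} ∩ {z : Plane | z j < q j} := by
      ext z; simp
    rw [this]
    exact isOpen_iInter_of_finite fun j => (isOpen_lt (by fun_prop) (by fun_prop)).inter
      (isOpen_lt (by fun_prop) (by fun_prop))
  · have := hpq j; simp only; linarith
  · have := hpq j; simp only; linarith

/-- The coordinatewise retraction of the plane onto a box. -/
noncomputable def clamp (p q : Fin 2 → ℝ) (z : Plane) : Plane :=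
  WithLp.toLp 2 fun j => max (p j) (min (q j) (z j))

theorem continuous_clamp (p q : Fin 2 → ℝ) : Continuous (clamp p q) :=
  (PiLp.continuous_toLp 2 _).comp (by fun_prop)

theorem clamp_mem {p q : Fin 2 → ℝ} (hpq : ∀ j, p j < q j) (z : Plane) : clamp p q z ∈ box p q :=
  fun j => ⟨le_max_left _ _, max_le (hpq j).le (min_le_left _ _)⟩

theorem clamp_of_mem {p q : Fin 2 → ℝ} {z : Plane} (hz : z ∈ box p q) : clamp p q z = z := by
  ext j
  simp [clamp, (hz j).1, (hz j).2]

/-! ### Mollification and the chain rule in `H¹`. -/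

open scoped Convolution

/-- The mollified value is the mean of `v (x - t)` under the probability measure with the bump as
density, and means of values in a closed convex set stay in it. -/
theorem normed_convolution_mem {K : Set Plane} (hK : Convex ℝ K) (hcl : IsClosed K)
    (hbd : Bornology.IsBounded K) {v : Plane → Plane} (hv : AEStronglyMeasurable v)
    (hvK : ∀ᵐ x, v x ∈ K) (f : ContDiffBump (0 : Plane)) (x : Plane) :
    (f.normed volume ⋆[ContinuousLinearMap.lsmul ℝ ℝ, volume] v) x ∈ K := by
  set ν : Measure Plane := volume.withDensity (fun t => ENNReal.ofReal (f.normed volume t)) with hν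
  have hfm : Measurable (f.normed volume) := f.continuous_normed.measurable
  have hprob : IsProbabilityMeasure ν := by
    refine ⟨?_⟩
    rw [hν, withDensity_apply _ MeasurableSet.univ, Measure.restrict_univ,
      ← ofReal_integral_eq_lintegral_ofReal f.integrable_normed
        (Eventually.of_forall fun t => f.nonneg_normed t), f.integral_normed, ENNReal.ofReal_one]
  have hmp : MeasurePreserving (fun t : Plane => x - t) volume volume :=
    Measure.measurePreserving_sub_left volume x
  have hac : ν ≪ volume := withDensity_absolutelyContinuous _ _
  have hmem : ∀ᵐ t ∂ν, v (x - t) ∈ K := hac.ae_le (hmp.quasiMeasurePreserving.ae hvK)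
  have hmeas : AEStronglyMeasurable (fun t => v (x - t)) ν :=
    (hv.comp_measurePreserving hmp).mono_ac hac
  obtain ⟨C, hC⟩ := hbd.exists_norm_le
  have hint : Integrable (fun t => v (x - t)) ν :=
    Integrable.of_bound hmeas C (hmem.mono fun t ht => hC _ ht)
  have := hK.integral_mem hcl hmem hint
  rw [hν, integral_withDensity_eq_integral_toReal_smul (by fun_prop) (by simp)] at this
  simp_rw [ENNReal.toReal_ofReal (f.nonneg_normed _)] at this
  simpa [convolution_def] using this

/-- Mollification commutes with weak differentiation away from the boundary. -/
theorem fderiv_normed_convolution_of_hasWeakJacobian {Ω : Set Plane} (hΩ : MeasurableSet Ω)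
    {u : X0 Ω} {J : Fin 2 → X0 Ω} (hJ : HasWeakJacobian Ω u J) {v : Plane → Plane}
    (hv : LocallyIntegrable v) (hvu : ∀ x ∈ Ω, v x = u x) (j : Fin 2)
    (hJi : LocallyIntegrable (Ω.indicator (J j))) (f : ContDiffBump (0 : Plane)) {x : Plane}
    (hx : Metric.closedBall x f.rOut ⊆ Ω) :
    fderiv ℝ (f.normed volume ⋆[ContinuousLinearMap.lsmul ℝ ℝ, volume] v) x
      (EuclideanSpace.single j 1) =
    (f.normed volume ⋆[ContinuousLinearMap.lsmul ℝ ℝ, volume] Ω.indicator (J j)) x := by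
  have hcs : HasCompactSupport (f.normed volume) := f.hasCompactSupport_normed
  have hsm : ContDiff ℝ ∞ (f.normed volume) := f.contDiff_normed
  have hsm1 : ContDiff ℝ 1 (f.normed volume) := f.contDiff_normed
  set e : Plane := EuclideanSpace.single j 1
  rw [(hcs.hasFDerivAt_convolution_left (ContinuousLinearMap.lsmul ℝ ℝ) hsm1 hv x).fderiv]
  have hex1 : ConvolutionExistsAt (fderiv ℝ (f.normed volume)) v x
      ((ContinuousLinearMap.lsmul ℝ ℝ).precompL Plane) volume :=
    (hcs.fderiv ℝ).convolutionExists_left _ (hsm1.continuous_fderiv one_ne_zero) hv x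
  have hex2 : ConvolutionExistsAt (f.normed volume) (Ω.indicator (J j)) x
      (ContinuousLinearMap.lsmul ℝ ℝ) volume :=
    hcs.convolutionExists_left _ hsm.continuous hJi x
  have h1 : ((fderiv ℝ (f.normed volume) ⋆[(ContinuousLinearMap.lsmul ℝ ℝ).precompL Plane,
      volume] v) x) e = ∫ t, fderiv ℝ (f.normed volume) (x - t) e • v t := by
    rw [convolution_def, ContinuousLinearMap.integral_apply hex1]
    rw [← integral_sub_left_eq_self _ volume x]
    simp [ContinuousLinearMap.precompL_apply]
  have hint1 : Integrable fun t => fderiv ℝ (f.normed volume) (x - t) e • v t := by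
    have hcs' : HasCompactSupport fun t => fderiv ℝ (f.normed volume) t e := hcs.fderiv_apply ℝ e
    have hct : Continuous fun t => fderiv ℝ (f.normed volume) t e :=
      (hsm1.continuous_fderiv one_ne_zero).clm_apply continuous_const
    exact (hcs'.convolutionExists_left (ContinuousLinearMap.lsmul ℝ ℝ) hct hv x).integrable_swap
  rw [h1, convolution_eq_swap]
  simp only [ContinuousLinearMap.lsmul_apply]
  have hint2 : Integrable fun t => f.normed volume (x - t) • Ω.indicator (J j) t :=
    hex2.integrable_swap
  -- The reflected kernel centred at `x` is the test function for the weak derivative; its support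
  -- lies in `Ω` by `hx`.
  set ψ : Plane → ℝ := fun t => f.normed volume (x - t) with hψ
  have hψsm : ContDiff ℝ ∞ ψ := hsm.comp (contDiff_const.sub contDiff_id)
  have hψsupp : tsupport ψ ⊆ Metric.closedBall x f.rOut := by
    refine closure_minimal (fun t ht => ?_) Metric.isClosed_closedBall
    have : x - t ∈ Function.support (f.normed volume) := ht
    rw [f.support_normed_eq, mem_ball_zero_iff, ← dist_eq_norm, dist_comm] at this
    exact Metric.ball_subset_closedBall this
  have hψcs : HasCompactSupport ψ :=
    (isCompact_closedBall x f.rOut).of_isClosed_subset (isClosed_tsupport _) hψsupp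
  have hψd : ∀ t, fderiv ℝ ψ t e = -fderiv ℝ (f.normed volume) (x - t) e := by
    intro t
    have h1 : HasFDerivAt (f.normed volume) (fderiv ℝ (f.normed volume) (x - t)) (x - t) :=
      (hsm.differentiable (by simp) _).hasFDerivAt
    have h2 : HasFDerivAt (fun t : Plane => x - t) (-ContinuousLinearMap.id ℝ Plane) t :=
      (hasFDerivAt_id t).const_sub x
    have := (h1.comp t h2).fderiv
    rw [show ψ = f.normed volume ∘ fun t => x - t from rfl, this]
    simp
  ext i
  have hc : ∀ g : Plane → Plane, Integrable g → (∫ t, g t) i = ∫ t, g t i := fun g hg =>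
    ((EuclideanSpace.proj i : Plane →L[ℝ] ℝ).integral_comp_comm hg).symm
  rw [hc _ hint1, hc _ hint2]
  have hw := hJ i j ψ hψsm hψcs (hψsupp.trans hx)
  have hl : ∫ t in Ω, u t i * fderiv ℝ ψ t e =
      -∫ t, (fderiv ℝ (f.normed volume) (x - t) e • v t) i := by
    have hvψ : ∀ t, -(fderiv ℝ (f.normed volume) (x - t) e • v t) i = v t i * fderiv ℝ ψ t e := by
      intro t
      simp only [PiLp.smul_apply, smul_eq_mul, hψd]
      ring
    rw [← integral_neg]
    simp_rw [hvψ]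
    refine Eq.trans ?_ (setIntegral_eq_integral_of_forall_compl_eq_zero (s := Ω) ?_)
    · exact setIntegral_congr_fun hΩ fun t ht => by simp only [hvu t ht]
    · intro t ht
      have : fderiv ℝ ψ t = 0 := by
        by_contra h
        exact ht (hx (hψsupp (support_fderiv_subset ℝ h)))
      simp [this]
  have hr : ∫ t in Ω, J j t i * ψ t = ∫ t, (ψ t • Ω.indicator (J j) t) i := by
    rw [← integral_indicator hΩ]
    congr 1
    ext t
    by_cases ht : t ∈ Ω
    · simp [indicator_of_mem ht, mul_comm]
    · simp [indicator_of_notMem ht]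
  change _ = ∫ t, (ψ t • Ω.indicator (J j) t) i
  rw [← hr]
  change ∫ t in Ω, u t i * fderiv ℝ ψ t e = _ at hw
  linarith

/-- The chain rule in `H¹` for a `C¹` function on a compact convex set of values. -/
theorem integral_comp_mul_fderiv_of_hasWeakJacobian {Ω : Set Plane} (hΩ : IsOpen Ω)
    (hΩb : Bornology.IsBounded Ω) {u : X0 Ω} {J : Fin 2 → X0 Ω} (hJ : HasWeakJacobian Ω u J)
    {K : Set Plane} (hK : Convex ℝ K) (hKc : IsCompact K) (hKne : K.Nonempty)
    (hKd : UniqueDiffOn ℝ K) (huK : ∀ᵐ x ∂(volume.restrict Ω), u x ∈ K) {g : Plane → ℝ}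
    (hg : ContDiffOn ℝ 1 g K) (j : Fin 2) {φ : Plane → ℝ} (hφ : ContDiff ℝ ∞ φ)
    (hφc : HasCompactSupport φ) (hφΩ : tsupport φ ⊆ Ω) :
    ∫ x in Ω, g (u x) * fderiv ℝ φ x (EuclideanSpace.single j 1) =
      -∫ x in Ω, fderivWithin ℝ g K (u x) (J j x) * φ x := by
  classical
  set e : Plane := EuclideanSpace.single j 1 with he
  have hfin : IsFiniteMeasure (volume.restrict Ω) :=
    ⟨by simpa using hΩb.measure_lt_top⟩
  obtain ⟨k, hk⟩ := hKne
  -- Extending by a point of `K` rather than by zero keeps all mollifications in `K`, where `g` is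
  -- controlled.
  set v : Plane → Plane := Ω.piecewise u (fun _ => k) with hv
  have hvm : AEStronglyMeasurable v :=
    ((Lp.stronglyMeasurable u).piecewise hΩ.measurableSet
      stronglyMeasurable_const).aestronglyMeasurable
  have hvK : ∀ᵐ x, v x ∈ K := by
    rw [ae_restrict_iff' hΩ.measurableSet] at huK
    filter_upwards [huK] with x hx
    by_cases hm : x ∈ Ω
    · simpa [hv, hm] using hx hm
    · simpa [hv, hm] using hk
  obtain ⟨R, hR⟩ := hKc.isBounded.exists_norm_le
  have hvl : LocallyIntegrable v :=
    (locallyIntegrable_const R).mono hvm (by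
      filter_upwards [hvK] with x hx
      exact (hR _ hx).trans (le_abs_self R))
  set I : Plane → Plane := Ω.indicator (J j) with hI
  have hIi : Integrable I :=
    (integrable_indicator_iff hΩ.measurableSet).2 ((Lp.memLp (J j)).integrable (by norm_num))
  obtain ⟨δ, hδ, hδΩ⟩ := hφc.isCompact.exists_cthickening_subset_open hΩ hφΩ
  set f : ℕ → ContDiffBump (0 : Plane) := fun n =>
    ⟨δ / (n + 2) / 2, δ / (n + 2), by positivity, half_lt_self (by positivity)⟩ with hf
  have hfout : ∀ n, (f n).rOut = δ / (n + 2) := fun n => rfl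
  have hflim : Tendsto (fun n => (f n).rOut) atTop (𝓝 0) := by
    simp_rw [hfout]
    have h1 : Tendsto (fun n : ℕ => (n : ℝ) + 2) atTop atTop :=
      tendsto_atTop_add_const_right _ _ tendsto_natCast_atTop_atTop
    exact tendsto_const_nhds.div_atTop h1
  have hfK : ∀ᶠ n in atTop, (f n).rOut ≤ 2 * (f n).rIn := by
    refine Eventually.of_forall fun n => ?_
    change δ / (n + 2) ≤ 2 * (δ / (n + 2) / 2)
    linarith
  have hfδ : ∀ n, (f n).rOut ≤ δ := fun n => by
    rw [hfout]
    have : (0 : ℝ) ≤ n := n.cast_nonneg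
    exact div_le_self hδ.le (by linarith)
  set un : ℕ → Plane → Plane := fun n =>
    (f n).normed volume ⋆[ContinuousLinearMap.lsmul ℝ ℝ, volume] v with hun
  set In : ℕ → Plane → Plane := fun n =>
    (f n).normed volume ⋆[ContinuousLinearMap.lsmul ℝ ℝ, volume] I with hIn
  -- The mollified norms dominate `‖In n x‖`. They vary with `n` but have constant integral, which
  -- is what the generalized dominated convergence needs.
  set Nn : ℕ → Plane → ℝ := fun n =>
    (f n).normed volume ⋆[ContinuousLinearMap.lsmul ℝ ℝ, volume] (fun x => ‖I x‖) with hNn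
  have hunK : ∀ n x, un n x ∈ K := fun n x =>
    normed_convolution_mem hK hKc.isClosed hKc.isBounded hvm hvK (f n) x
  have hunsm : ∀ n, ContDiff ℝ 1 (un n) := fun n =>
    (f n).hasCompactSupport_normed.contDiff_convolution_left _ (n := 1)
      (f n).contDiff_normed hvl
  have hIcont : ∀ n, Continuous (In n) := fun n =>
    (f n).hasCompactSupport_normed.continuous_convolution_left _ (f n).continuous_normed
      hIi.locallyIntegrable
  have hulim : ∀ᵐ x, Tendsto (fun n => un n x) atTop (𝓝 (v x)) :=
    ContDiffBump.ae_convolution_tendsto_right_of_locallyIntegrable hflim hfK hvl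
  have hIlim : ∀ᵐ x, Tendsto (fun n => In n x) atTop (𝓝 (I x)) :=
    ContDiffBump.ae_convolution_tendsto_right_of_locallyIntegrable hflim hfK hIi.locallyIntegrable
  have hNlim : ∀ᵐ x, Tendsto (fun n => Nn n x) atTop (𝓝 ‖I x‖) :=
    ContDiffBump.ae_convolution_tendsto_right_of_locallyIntegrable hflim hfK
      hIi.norm.locallyIntegrable
  have hIN : ∀ n x, ‖In n x‖ ≤ Nn n x := by
    intro n x
    refine (norm_integral_le_integral_norm _).trans (le_of_eq ?_)
    refine integral_congr_ae (Eventually.of_forall fun t => ?_)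
    simp [norm_smul, abs_of_nonneg ((f n).nonneg_normed (μ := volume) t)]
  have hNi : ∀ n, Integrable (Nn n) := fun n =>
    (f n).integrable_normed.integrable_convolution _ hIi.norm
  have hNint : ∀ n, ∫ x, Nn n x = ∫ x, ‖I x‖ := by
    intro n
    rw [hNn]
    simp only
    rw [integral_convolution _ (f n).integrable_normed hIi.norm, (f n).integral_normed]
    simp
  have hDc : ContinuousOn (fderivWithin ℝ g K) K := hg.continuousOn_fderivWithin hKd le_rfl
  obtain ⟨C₀, hC₀⟩ := hKc.exists_bound_of_continuousOn hg.continuousOn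
  obtain ⟨C₁, hC₁⟩ := hKc.exists_bound_of_continuousOn hDc
  obtain ⟨C₂, hC₂⟩ := hφ.continuous.bounded_above_of_compact_support hφc
  have hφd : Continuous fun x => fderiv ℝ φ x e :=
    (hφ.continuous_fderiv (by simp)).clm_apply continuous_const
  have hφdc : HasCompactSupport fun x => fderiv ℝ φ x e := hφc.fderiv_apply ℝ e
  have hsm : ∀ n, ContDiff ℝ 1 (g ∘ un n) := fun n => hg.comp_contDiff (hunsm n) (hunK n)
  have hchain : ∀ n x, fderiv ℝ (g ∘ un n) x e =
      fderivWithin ℝ g K (un n x) (fderiv ℝ (un n) x e) := by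
    intro n x
    have h1 : HasFDerivWithinAt g (fderivWithin ℝ g K (un n x)) K (un n x) :=
      (hg.differentiableOn one_ne_zero _ (hunK n x)).hasFDerivWithinAt
    have h2 : HasFDerivAt (un n) (fderiv ℝ (un n) x) x :=
      ((hunsm n).differentiable one_ne_zero x).hasFDerivAt
    have h3 := h1.comp x (h2.hasFDerivWithinAt (s := univ)) fun y _ => hunK n y
    rw [hasFDerivWithinAt_univ] at h3
    rw [h3.fderiv]
    rfl
  have happrox : ∀ n, ∫ x, g (un n x) * fderiv ℝ φ x e =
      -∫ x, fderivWithin ℝ g K (un n x) (In n x) * φ x := by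
    intro n
    have hc1 : Continuous fun x => fderiv ℝ (g ∘ un n) x e :=
      ((hsm n).continuous_fderiv one_ne_zero).clm_apply continuous_const
    have h := integral_mul_fderiv_eq_neg_fderiv_mul_of_integrable (μ := volume) (f := g ∘ un n)
      (g := φ) (v := e)
      ((hc1.mul hφ.continuous).integrable_of_hasCompactSupport hφc.mul_left)
      (((hsm n).continuous.mul hφd).integrable_of_hasCompactSupport hφdc.mul_left)
      (((hsm n).continuous.mul hφ.continuous).integrable_of_hasCompactSupport hφc.mul_left)
      (fun x _ => (hsm n).differentiable one_ne_zero x)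
      (fun x _ => hφ.differentiable (by simp) x)
    refine h.trans ?_
    congr 1
    refine integral_congr_ae (Eventually.of_forall fun x => ?_)
    simp only
    by_cases hx : x ∈ tsupport φ
    · rw [hchain, hun]
      simp only
      rw [fderiv_normed_convolution_of_hasWeakJacobian hΩ.measurableSet hJ hvl
        (fun y hy => by simp [hv, hy]) j hIi.locallyIntegrable (f n)]
      refine (Metric.closedBall_subset_closedBall (hfδ n)).trans
        ((Metric.closedBall_subset_cthickening hx δ).trans hδΩ)
    · simp [image_eq_zero_of_notMem_tsupport hx]
  have hlim1 : Tendsto (fun n => ∫ x, g (un n x) * fderiv ℝ φ x e) atTop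
      (𝓝 (∫ x, g (v x) * fderiv ℝ φ x e)) := by
    refine tendsto_integral_of_dominated_convergence (fun x => C₀ * ‖fderiv ℝ φ x e‖) ?_ ?_ ?_ ?_
    · exact fun n => ((hsm n).continuous.mul hφd).aestronglyMeasurable
    · exact ((hφd.integrable_of_hasCompactSupport hφdc).norm).const_mul _
    · intro n
      refine Eventually.of_forall fun x => ?_
      rw [norm_mul]
      gcongr
      exact hC₀ _ (hunK n x)
    · filter_upwards [hulim, hvK] with x h1 h2
      have h3 : Tendsto (fun n => un n x) atTop (𝓝[K] (v x)) :=
        tendsto_nhdsWithin_iff.2 ⟨h1, Eventually.of_forall fun n => hunK n x⟩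
      exact ((hg.continuousOn _ h2).tendsto.comp h3).mul_const _
  have hlim2 : Tendsto (fun n => ∫ x, fderivWithin ℝ g K (un n x) (In n x) * φ x) atTop
      (𝓝 (∫ x, fderivWithin ℝ g K (v x) (I x) * φ x)) := by
    have hC₁0 : 0 ≤ C₁ := (norm_nonneg _).trans (hC₁ k hk)
    refine tendsto_integral_of_dominated_of_tendsto_integral
      (g := fun n x => C₁ * C₂ * Nn n x) (G := fun x => C₁ * C₂ * ‖I x‖) ?_ ?_ ?_ ?_ ?_ ?_ ?_
    · intro n
      exact (((hDc.comp_continuous (hunsm n).continuous (hunK n)).clm_apply (hIcont n)).mul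
        hφ.continuous).aestronglyMeasurable
    · exact fun n => (hNi n).const_mul _
    · exact hIi.norm.const_mul _
    · intro n
      refine Eventually.of_forall fun x => ?_
      rw [abs_mul, mul_right_comm]
      have h1 : |fderivWithin ℝ g K (un n x) (In n x)| ≤ C₁ * Nn n x :=
        (ContinuousLinearMap.le_of_opNorm_le _ (hC₁ _ (hunK n x)) _).trans
          (mul_le_mul_of_nonneg_left (hIN n x) hC₁0)
      exact mul_le_mul h1 (hC₂ x) (abs_nonneg _) ((abs_nonneg _).trans h1)
    · filter_upwards [hulim, hIlim, hvK] with x h1 hI1 h2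
      have h3 : Tendsto (fun n => un n x) atTop (𝓝[K] (v x)) :=
        tendsto_nhdsWithin_iff.2 ⟨h1, Eventually.of_forall fun n => hunK n x⟩
      have h4 : Tendsto (fun n => fderivWithin ℝ g K (un n x)) atTop
          (𝓝 (fderivWithin ℝ g K (v x))) := (hDc _ h2).tendsto.comp h3
      have h5 : Tendsto (fun n => fderivWithin ℝ g K (un n x) (In n x)) atTop
          (𝓝 (fderivWithin ℝ g K (v x) (I x))) :=
        (isBoundedBilinearMap_apply.continuous.tendsto
          (fderivWithin ℝ g K (v x), I x)).comp (h4.prodMk_nhds hI1)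
      exact h5.mul_const _
    · filter_upwards [hNlim] with x hx
      exact hx.const_mul _
    · simp_rw [integral_const_mul, hNint]
      exact tendsto_const_nhds
  have hfinal : ∫ x, g (v x) * fderiv ℝ φ x e = -∫ x, fderivWithin ℝ g K (v x) (I x) * φ x := by
    simp_rw [happrox] at hlim1
    exact tendsto_nhds_unique hlim1 hlim2.neg
  have e1 : ∫ x in Ω, g (u x) * fderiv ℝ φ x e = ∫ x, g (v x) * fderiv ℝ φ x e := by
    refine Eq.trans (setIntegral_congr_fun hΩ.measurableSet fun x hx => ?_)
      (setIntegral_eq_integral_of_forall_compl_eq_zero (s := Ω) fun x hx => ?_)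
    · simp [hv, hx]
    · have : fderiv ℝ φ x = 0 := by
        by_contra h
        exact hx (hφΩ (support_fderiv_subset ℝ h))
      simp [this]
  have e2 : ∫ x in Ω, fderivWithin ℝ g K (u x) (J j x) * φ x =
      ∫ x, fderivWithin ℝ g K (v x) (I x) * φ x := by
    refine Eq.trans (setIntegral_congr_fun hΩ.measurableSet fun x hx => ?_)
      (setIntegral_eq_integral_of_forall_compl_eq_zero (s := Ω) fun x hx => ?_)
    · simp [hv, hI, hx]
    · simp [hI, hx]
  rw [e1, e2, hfinal]

theorem hasWeakJacobian_comp {Ω : Set Plane} (hΩ : IsOpen Ω)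
    (hΩb : Bornology.IsBounded Ω) {u : X0 Ω} {J : Fin 2 → X0 Ω} (hJ : HasWeakJacobian Ω u J)
    {K : Set Plane} (hK : Convex ℝ K) (hKc : IsCompact K) (hKne : K.Nonempty)
    (hKd : UniqueDiffOn ℝ K) (huK : ∀ᵐ x ∂(volume.restrict Ω), u x ∈ K) {G : Plane → Plane}
    (hG : ContDiffOn ℝ 1 G K) {w : X0 Ω} {Jw : Fin 2 → X0 Ω}
    (hw : ∀ᵐ x ∂(volume.restrict Ω), w x = G (u x))
    (hJw : ∀ j, ∀ᵐ x ∂(volume.restrict Ω), Jw j x = fderivWithin ℝ G K (u x) (J j x)) :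
    HasWeakJacobian Ω w Jw := by
  intro i j φ hφ hφc hφΩ
  set P : Plane →L[ℝ] ℝ := EuclideanSpace.proj i
  have h := integral_comp_mul_fderiv_of_hasWeakJacobian hΩ hΩb hJ hK hKc hKne hKd huK
    (g := P ∘ G) (P.contDiff.comp_contDiffOn hG) j hφ hφc hφΩ
  have e1 : ∫ x in Ω, w x i * fderiv ℝ φ x (EuclideanSpace.single j 1) =
      ∫ x in Ω, (P ∘ G) (u x) * fderiv ℝ φ x (EuclideanSpace.single j 1) :=
    integral_congr_ae (by
      filter_upwards [hw] with x hx
      rw [hx]; rfl)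
  have e2 : ∫ x in Ω, Jw j x i * φ x =
      ∫ x in Ω, fderivWithin ℝ (P ∘ G) K (u x) (J j x) * φ x :=
    integral_congr_ae (by
      filter_upwards [hJw j, huK] with x hx hxK
      have h1 := (hG.differentiableOn one_ne_zero _ hxK).hasFDerivWithinAt
      rw [hx, (P.hasFDerivAt.comp_hasFDerivWithinAt _ h1).fderivWithin (hKd _ hxK)]
      rfl)
  rw [e1, e2, h]


/-! ### Initial bounds and constant test functions. -/

theorem ae_mem_box_of_bounds {Ω : Set Plane} {u₀ : X0 Ω}
    (hbdd : ∀ j, MemLp (fun x => u₀ x j) ⊤ (volume.restrict Ω))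
    (hnonneg : ∀ᵐ x ∂(volume.restrict Ω), ∀ j, 0 ≤ u₀ x j) {p q : Fin 2 → ℝ}
    (hp : ∀ j, p j ≤ lowerBound u₀ j) (hq : ∀ j, upperBound u₀ j ≤ q j) :
    ∀ᵐ x ∂(volume.restrict Ω), u₀ x ∈ box p q := by
  have hlow : ∀ j, ∀ᵐ x ∂(volume.restrict Ω), lowerBound u₀ j ≤ u₀ x j := fun j =>
    -- Nonnegativity supplies the lower bound that makes the real-valued `essInf` meaningful.
    ae_essInf_le ⟨0, by
      rw [eventually_map]
      exact hnonneg.mono fun x hx => hx j⟩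
  have hup : ∀ j, ∀ᵐ x ∂(volume.restrict Ω), u₀ x j ≤ upperBound u₀ j := fun j => by
    filter_upwards [ae_le_eLpNormEssSup (f := fun x => u₀ x j) (μ := volume.restrict Ω)] with x hx
    rw [← eLpNorm_exponent_top] at hx
    have := ENNReal.toReal_mono (hbdd j).2.ne hx
    rw [toReal_enorm] at this
    exact (le_abs_self _).trans this
  filter_upwards [ae_all_iff.2 hlow, ae_all_iff.2 hup] with x h1 h2 j
  exact ⟨(hp j).trans (h1 j), (h2 j).trans (hq j)⟩

theorem hasWeakJacobian_const {Ω : Set Plane} [IsFiniteMeasure (volume.restrict Ω)] (c : Plane) :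
    HasWeakJacobian Ω (Lp.const 2 (volume.restrict Ω) c) 0 := by
  intro i j φ hφ hφc hφΩ
  set e : Plane := EuclideanSpace.single j 1
  have hφd : Continuous fun x => fderiv ℝ φ x e :=
    (hφ.continuous_fderiv (by simp)).clm_apply continuous_const
  have h := integral_mul_fderiv_eq_neg_fderiv_mul_of_integrable (μ := volume)
    (f := fun _ : Plane => c i) (g := φ) (v := e) (by simp)
    ((hφd.integrable_of_hasCompactSupport (hφc.fderiv_apply ℝ e)).const_mul _)
    ((hφ.continuous.integrable_of_hasCompactSupport hφc).const_mul _)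
    (fun x _ => differentiableAt_const _) (fun x _ => hφ.differentiable (by simp) x)
  have e1 : ∫ x in Ω, Lp.const 2 (volume.restrict Ω) c x i * fderiv ℝ φ x e =
      ∫ x in Ω, c i * fderiv ℝ φ x e := integral_congr_ae (by
    filter_upwards [Lp.coeFn_const (p := 2) (μ := volume.restrict Ω) (c := c)] with x hx
    rw [hx]; rfl)
  have e2 : ∫ x in Ω, (0 : Fin 2 → X0 Ω) j x i * φ x = 0 := by
    rw [← integral_zero Plane ℝ (μ := volume.restrict Ω)]
    refine integral_congr_ae ?_
    filter_upwards [Lp.coeFn_zero Plane 2 (volume.restrict Ω)] with x hx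
    rw [Pi.zero_apply, hx]; simp
  rw [e1, e2, setIntegral_eq_integral_of_forall_compl_eq_zero, h]
  · simp
  · intro x hx
    have : fderiv ℝ φ x = 0 := by
      by_contra h
      exact hx (hφΩ (support_fderiv_subset ℝ h))
    simp [this]

/-! ### Gradient, Hessian and pointwise dissipation. -/

theorem contDiffOn_gradientWithin {K : Set Plane} {r : Plane → ℝ} (hK : UniqueDiffOn ℝ K)
    (hr : ContDiffOn ℝ 2 r K) : ContDiffOn ℝ 1 (gradientWithin r K) K :=
  (InnerProductSpace.toDual ℝ Plane).symm.contDiff.comp_contDiffOn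
    (hr.fderivWithin hK (by norm_num))

theorem inner_gradientWithin {K : Set Plane} {r : Plane → ℝ} (z η : Plane) :
    inner ℝ (gradientWithin r K z) η = fderivWithin ℝ r K z η := by
  rw [gradientWithin, InnerProductSpace.toDual_symm_apply]

/-- Both sides are derivatives within `K` of the same function `y ↦ fderivWithin ℝ r K y η`, and
such derivatives are unique. -/
theorem inner_fderivWithin_gradientWithin {K : Set Plane} {r : Plane → ℝ} (hK : UniqueDiffOn ℝ K)
    (hr : ContDiffOn ℝ 2 r K) {z : Plane} (hz : z ∈ K) (ξ η : Plane) :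
    inner ℝ (fderivWithin ℝ (gradientWithin r K) K z ξ) η =
      fderivWithin ℝ (fderivWithin ℝ r K) K z ξ η := by
  have hd : ContDiffOn ℝ 1 (fderivWithin ℝ r K) K := hr.fderivWithin hK (by norm_num)
  have h1 := (hd.differentiableOn one_ne_zero z hz).hasFDerivWithinAt
  have h2 := ((contDiffOn_gradientWithin hK hr).differentiableOn one_ne_zero z hz).hasFDerivWithinAt
  have h3 := (ContinuousLinearMap.apply ℝ ℝ η).hasFDerivAt.comp_hasFDerivWithinAt z h1
  have h4 := (innerSL ℝ η).hasFDerivAt.comp_hasFDerivWithinAt z h2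
  have heq : (⇑(innerSL ℝ η) ∘ gradientWithin r K) =
      (⇑(ContinuousLinearMap.apply ℝ ℝ η) ∘ fderivWithin ℝ r K) := by
    ext y
    simp
  rw [heq] at h4
  have := congr_arg (fun L => L ξ) ((hK z hz).eq h4 h3)
  rw [real_inner_comm]
  exact this

theorem fderivWithin_fderivWithin_eq_dotProduct_hessian (K : Set Plane) (r : Plane → ℝ)
    (z ξ η : Plane) : fderivWithin ℝ (fderivWithin ℝ r K) K z ξ η =
      ξ.ofLp ⬝ᵥ (hessian K r z *ᵥ η.ofLp) := by
  have hexp : ∀ ζ : Plane, ζ = ζ 0 • EuclideanSpace.single 0 1 + ζ 1 • EuclideanSpace.single 1 1 := by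
    intro ζ
    ext i
    fin_cases i <;> simp
  conv_lhs => rw [hexp ξ, hexp η]
  simp only [map_add, map_smul, add_apply, smul_apply, smul_eq_mul, dotProduct, Matrix.mulVec,
    Fin.sum_univ_two, hessian, Matrix.of_apply]
  ring

/-- Where `D` commutes with the Hessian of the convex function `r`, the energy density of `r` is
dissipated. -/
theorem inner_fderivWithin_gradientWithin_mulVec_nonneg {K : Set Plane} {r : Plane → ℝ}
    (hK : UniqueDiffOn ℝ K) (hcl : K ⊆ closure (interior K)) (hr : ContDiffOn ℝ 2 r K)
    (hconv : ConvexOn ℝ K r) {z : Plane} (hz : z ∈ K) {A : Matrix (Fin 2) (Fin 2) ℝ}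
    (hA : ∀ ξ : Fin 2 → ℝ, 0 ≤ ξ ⬝ᵥ (A *ᵥ ξ)) (hcomm : hessian K r z * A = A * hessian K r z)
    (ξ : Plane) :
    0 ≤ inner ℝ (fderivWithin ℝ (gradientWithin r K) K z ξ)
      (Matrix.toEuclideanCLM (n := Fin 2) (𝕜 := ℝ) A ξ) := by
  have hsymm : (hessian K r z).IsHermitian := by
    ext i j
    simp only [Matrix.conjTranspose_apply, star_trivial, hessian, Matrix.of_apply]
    exact ((hr z hz).isSymmSndFDerivWithinAt (by simp) hK (hcl hz) hz).eq _ _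
  have hpsd : (hessian K r z).PosSemidef := by
    refine .of_dotProduct_mulVec_nonneg hsymm fun ζ => ?_
    have := hconv.fderivWithin_fderivWithin_nonneg hK hcl hr hz (WithLp.toLp 2 ζ)
    rw [fderivWithin_fderivWithin_eq_dotProduct_hessian] at this
    simpa using this
  have h := hpsd.dotProduct_mul_mulVec_nonneg_of_commute hcomm hA ξ.ofLp
  rw [inner_fderivWithin_gradientWithin hK hr hz, fderivWithin_fderivWithin_eq_dotProduct_hessian,
    Matrix.ofLp_toEuclideanCLM, Matrix.dotProduct_mulVec, ← Matrix.mulVec_transpose]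
  have ht : (hessian K r z)ᵀ = hessian K r z := by
    rw [← Matrix.conjTranspose_eq_transpose_of_trivial]
    exact hsymm
  rwa [ht]

/-! ### Hilbert space form of the equation and of `Φ_r`. -/

theorem diffusionForm_eq_sum_inner {Ω : Set Plane} {D : Plane → Matrix (Fin 2) (Fin 2) ℝ}
    {u : X0 Ω} {J Jw A : Fin 2 → X0 Ω} (hA : ∀ j, ∀ᵐ x ∂(volume.restrict Ω),
      A j x = Matrix.toEuclideanCLM (n := Fin 2) (𝕜 := ℝ) (D (u x)) (J j x)) :
    diffusionForm Ω D u J Jw = ∑ j, inner ℝ (Jw j) (A j) := by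
  simp_rw [L2.inner_def]
  rw [← integral_finsetSum _ fun j _ => L2.integrable_inner (Jw j) (A j)]
  refine integral_congr_ae ?_
  filter_upwards [ae_all_iff.2 hA] with x hx
  simp only [hx, PiLp.inner_apply, Matrix.ofLp_toEuclideanCLM, Fin.sum_univ_two, Matrix.trace,
    Matrix.diag_apply, Matrix.mul_apply, Matrix.transpose_apply, jacobianAt, Matrix.of_apply,
    Matrix.mulVec, dotProduct, RCLike.inner_apply, conj_trivial]
  ring

/-- The integral is the pairing of the constant `1` with its multiple by `ρ(v)`, so
`continuous_mulLp` applies. -/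
theorem continuous_integral_comp {Ω : Set Plane} [IsFiniteMeasure (volume.restrict Ω)]
    {ρ : Plane → ℝ} (hρ : Continuous ρ) {C : ℝ} (hC : ∀ z, ‖ρ z‖ ≤ C) :
    Continuous fun v : X0 Ω => ∫ x in Ω, ρ (v x) := by
  set M : Plane → ℝ →L[ℝ] ℝ := fun z => ρ z • ContinuousLinearMap.id ℝ ℝ
  have hM : Continuous M := hρ.smul continuous_const
  have hMC : ∀ z, ‖M z‖ ≤ C := fun z => by
    simpa [M, norm_smul] using hC z
  set c : Lp ℝ 2 (volume.restrict Ω) := Lp.const 2 (volume.restrict Ω) 1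
  have h : ∀ v : X0 Ω, ∫ x in Ω, ρ (v x) = inner ℝ c (mulLp hM hMC v c) := by
    intro v
    rw [L2.inner_def]
    refine integral_congr_ae ?_
    filter_upwards [coeFn_mulLp hM hMC v c,
      Lp.coeFn_const (p := 2) (μ := volume.restrict Ω) (c := (1 : ℝ))] with x h1 h2
    rw [h1, h2]
    simp [M]
  simp_rw [h]
  exact continuous_const.inner
    ((continuous_mulLp hM hMC).comp (continuous_id.prodMk continuous_const))

theorem memLp_comp {Ω : Set Plane} [IsFiniteMeasure (volume.restrict Ω)]
    {F : Type*} [NormedAddCommGroup F] {ρ : Plane → F} (hρ : Continuous ρ) {C : ℝ}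
    (hC : ∀ z, ‖ρ z‖ ≤ C) (v : X0 Ω) (s : ENNReal) :
    MemLp (fun x => ρ (v x)) s (volume.restrict Ω) :=
  MemLp.of_bound (hρ.comp_aestronglyMeasurable (Lp.aestronglyMeasurable v)) C
    (Eventually.of_forall fun _ => hC _)

/-- The integrated tangent inequality at `a`; it stands in for a chain rule in time. -/
theorem Phi_sub_le_inner {Ω : Set Plane} {K : Set Plane} {r : Plane → ℝ}
    (hr : ContDiffOn ℝ 2 r K) (hconv : ConvexOn ℝ K r) {a b w : X0 Ω}
    (ha : ∀ᵐ x ∂(volume.restrict Ω), a x ∈ K) (hb : ∀ᵐ x ∂(volume.restrict Ω), b x ∈ K)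
    (hra : IntegrableOn (fun x => r (a x)) Ω) (hrb : IntegrableOn (fun x => r (b x)) Ω)
    (hw : ∀ᵐ x ∂(volume.restrict Ω), w x = gradientWithin r K (a x)) :
    Phi Ω r a - Phi Ω r b ≤ inner ℝ (a - b) w := by
  rw [Phi, Phi, ← integral_sub hra hrb, L2.inner_def]
  refine integral_mono_ae (hra.sub hrb) (L2.integrable_inner _ _) ?_
  filter_upwards [ha, hb, hw, Lp.coeFn_sub a b] with x h1 h2 h3 h4
  rw [h3, h4, real_inner_comm, inner_gradientWithin]
  exact hconv.sub_le_fderivWithin h1 h2 (hr.differentiableOn two_ne_zero _ h1)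

theorem integral_eq_of_forall_inner_const {Ω : Set Plane} [IsFiniteMeasure (volume.restrict Ω)]
    {v w : X0 Ω} (h : ∀ c : Plane, inner ℝ v (Lp.const 2 (volume.restrict Ω) c) =
      inner ℝ w (Lp.const 2 (volume.restrict Ω) c)) : ∫ x in Ω, v x = ∫ x in Ω, w x := by
  have key : ∀ (z : X0 Ω) (c : Plane), inner ℝ z (Lp.const 2 (volume.restrict Ω) c) =
      inner ℝ c (∫ x in Ω, z x) := by
    intro z c
    rw [L2.inner_def, ← integral_inner ((Lp.memLp z).integrable (by norm_num))]
    refine integral_congr_ae ?_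
    filter_upwards [Lp.coeFn_const (p := 2) (μ := volume.restrict Ω) (c := c)] with x hx
    rw [hx, real_inner_comm]
    rfl
  refine ext_inner_left ℝ fun c => ?_
  rw [← key, ← key, h]

theorem mean_eq_average {Ω : Set Plane} [IsFiniteMeasure (volume.restrict Ω)] (w : X0 Ω) :
    mean w = ⨍ x in Ω, w x := by
  ext j
  simp only [mean, setAverage_eq, PiLp.smul_apply]
  rw [eval_integral_piLp fun i =>
    ((Lp.memLp w).integrable (by norm_num : (1 : ENNReal) ≤ 2)).eval_piLp i]

/-- Jensen's inequality for the functional `Φ_r`. -/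
theorem Phi_average_le {Ω : Set Plane} [IsFiniteMeasure (volume.restrict Ω)]
    (hΩ : volume Ω ≠ 0) {K : Set Plane} (hKc : IsClosed K) {r : Plane → ℝ}
    (hconv : ConvexOn ℝ K r) (hcont : ContinuousOn r K) {w : X0 Ω}
    (hw : ∀ᵐ x ∂(volume.restrict Ω), w x ∈ K) (hr : IntegrableOn (fun x => r (w x)) Ω) :
    Phi Ω r (fun _ => ⨍ x in Ω, w x) ≤ Phi Ω r w := by
  have hfin : volume Ω ≠ ⊤ := by
    simpa using measure_ne_top (volume.restrict Ω) univ
  have hpos : 0 < volume.real Ω := ENNReal.toReal_pos hΩ hfin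
  have h := hconv.map_set_average_le hcont hKc hΩ hfin hw
    ((Lp.memLp w).integrable (by norm_num)) hr
  rw [setAverage_eq _ (fun x => r (w x)), smul_eq_mul, inv_mul_eq_div, le_div_iff₀ hpos] at h
  simp only [Phi, integral_const, measureReal_restrict_apply_univ, smul_eq_mul]
  linarith


theorem memLp_mulLp_of_continuousOn {Ω : Set Plane} {T : ℝ} {u J : ℝ → X0 Ω}
    (hu : ContinuousOn u (Icc 0 T)) (hJ : MemLp J 2 (volume.restrict (Ioc 0 T)))
    {M : Plane → Plane →L[ℝ] Plane} (hM : Continuous M) {C : ℝ} (hC : ∀ z, ‖M z‖ ≤ C) :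
    MemLp (fun t => mulLp hM hC (u t) (J t)) 2 (volume.restrict (Ioc 0 T)) := by
  have hum : AEStronglyMeasurable u (volume.restrict (Ioc 0 T)) :=
    (hu.mono Ioc_subset_Icc_self).aestronglyMeasurable measurableSet_Ioc
  exact hJ.of_le_mul (c := C)
    ((continuous_mulLp hM hC).comp_aestronglyMeasurable (hum.prodMk hJ.1))
    (Eventually.of_forall fun t => norm_mulLp_le hM hC _ _)

theorem IsDiffusionMatrix.continuous {D : Plane → Matrix (Fin 2) (Fin 2) ℝ}
    (hD : IsDiffusionMatrix D) : Continuous D := by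
  obtain ⟨L, hL, h⟩ := hD.lipschitz
  refine continuous_matrix fun i j => ?_
  refine LipschitzWith.continuous (K := ⟨L, hL.le⟩) (LipschitzWith.of_dist_le_mul fun x y => ?_)
  rw [Real.dist_eq, dist_eq_norm]
  exact h y x i j

theorem IsDiffusionMatrix.dotProduct_mulVec_nonneg {D : Plane → Matrix (Fin 2) (Fin 2) ℝ}
    (hD : IsDiffusionMatrix D) (z : Plane) (ξ : Fin 2 → ℝ) : 0 ≤ ξ ⬝ᵥ (D z *ᵥ ξ) := by
  obtain ⟨α, hα, h⟩ := hD.posDef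
  refine le_trans (mul_nonneg hα.le ?_) (h z ξ)
  simpa using dotProduct_star_self_nonneg ξ

theorem continuous_toEuclideanCLM :
    Continuous (fun A : Matrix (Fin 2) (Fin 2) ℝ =>
      Matrix.toEuclideanCLM (n := Fin 2) (𝕜 := ℝ) A) :=
  LinearMap.continuous_of_finiteDimensional
    (Matrix.toEuclideanCLM (n := Fin 2) (𝕜 := ℝ)).toAlgEquiv.toLinearMap

end CrossDiffusion

/-! ### The Lyapunov property. -/

theorem lemma6 (Ω : Set Plane) (hΩ_open : IsOpen Ω) (hΩ_conn : IsConnected Ω)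
    (hΩ_bdd : Bornology.IsBounded Ω)
    (D : Plane → Matrix (Fin 2) (Fin 2) ℝ) (hD : IsDiffusionMatrix D)
    (T : ℝ) (hT : 0 < T)
    -- bounded nonnegative initial data and a weak solution
    (u₀ : X0 Ω) (hu₀_bdd : ∀ j, MemLp (fun x => u₀ x j) ⊤ (volume.restrict Ω))
    (hu₀_nonneg : ∀ᵐ x ∂(volume.restrict Ω), ∀ j, 0 ≤ u₀ x j)
    (u : ℝ → X0 Ω) (hu : IsWeakSolution Ω D T u₀ u)
    -- a nondegenerate closed box containing the box of the extremum bounds of `u₀`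
    -- (in particular that box itself)
    (p q : Fin 2 → ℝ) (hpq : ∀ j, p j < q j)
    (hp : ∀ j, p j ≤ lowerBound u₀ j) (hq : ∀ j, upperBound u₀ j ≤ q j)
    (r : Plane → ℝ) (hr_smooth : ContDiffOn ℝ 2 r (box p q)) (hr_convex : ConvexOn ℝ (box p q) r)
    -- along the solution the Hessian of `r` is defined and commutes with `D`
    (hcomm : ∀ t ∈ Ioc 0 T, ∀ᵐ x ∂(volume.restrict Ω), u t x ∈ box p q ∧
      hessian (box p q) r (u t x) * D (u t x) = D (u t x) * hessian (box p q) r (u t x)) :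
    (∀ t ∈ Icc 0 T, IntegrableOn (fun x => r (u t x)) Ω) ∧
    ContinuousOn (fun t => Phi Ω r (u t)) (Icc 0 T) ∧
    AntitoneOn (fun t => Phi Ω r (u t)) (Icc 0 T) ∧
    ∀ t ∈ Icc 0 T, Phi Ω r (fun _ => mean u₀) ≤ Phi Ω r (u t) := by
  have hfin : IsFiniteMeasure (volume.restrict Ω) := ⟨by simpa using hΩ_bdd.measure_lt_top⟩
  set K : Set Plane := box p q with hKdef
  have hKconv : Convex ℝ K := convex_box p q
  have hKc : IsCompact K := isCompact_box p q
  have hKi : (interior K).Nonempty := nonempty_interior_box hpq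
  have hKd : UniqueDiffOn ℝ K := uniqueDiffOn_convex hKconv hKi
  have hKcl : K ⊆ closure (interior K) := by
    rw [hKconv.closure_interior_eq_closure_of_nonempty_interior hKi]
    exact subset_closure
  have huK : ∀ t ∈ Icc 0 T, ∀ᵐ x ∂(volume.restrict Ω), u t x ∈ K := by
    intro t ht
    -- `hcomm` covers only positive times; at time zero the extremum bounds of `u₀` are used.
    rcases ht.1.eq_or_lt with h0 | h0
    · rw [← h0, hu.initial]
      exact ae_mem_box_of_bounds hu₀_bdd hu₀_nonneg hp hq
    · exact (hcomm t ⟨h0, ht.2⟩).mono fun x hx => hx.1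
  -- a continuous function on the box, composed with the retraction, is continuous and bounded
  have hext : ∀ {F : Type} [NormedAddCommGroup F] {g : Plane → F}, ContinuousOn g K →
      Continuous (fun z => g (clamp p q z)) ∧ ∃ C, ∀ z, ‖g (clamp p q z)‖ ≤ C := by
    intro F _ g hg
    obtain ⟨C, hC⟩ := hKc.exists_bound_of_continuousOn hg
    exact ⟨hg.comp_continuous (continuous_clamp p q) (clamp_mem hpq), C, fun z =>
      hC _ (clamp_mem hpq z)⟩
  obtain ⟨hrc, Cr, hCr⟩ := hext hr_smooth.continuousOn
  have hGd := contDiffOn_gradientWithin hKd hr_smooth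
  obtain ⟨hGc, CG, hCG⟩ := hext hGd.continuousOn
  obtain ⟨hHc, CH, hCH⟩ := hext (hGd.continuousOn_fderivWithin hKd le_rfl)
  obtain ⟨hDc, CD, hCD⟩ := hext (g := fun z => Matrix.toEuclideanCLM (n := Fin 2) (𝕜 := ℝ) (D z))
    (continuous_toEuclideanCLM.comp hD.continuous).continuousOn
  have hrint : ∀ t ∈ Icc 0 T, IntegrableOn (fun x => r (u t x)) Ω := by
    intro t ht
    refine ((memLp_comp hrc hCr (u t) 1).integrable le_rfl).congr ?_
    filter_upwards [huK t ht] with x hx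
    rw [clamp_of_mem hx]
  have hΦ : ∀ t ∈ Icc 0 T, Phi Ω r (u t) = ∫ x in Ω, r (clamp p q (u t x)) := by
    intro t ht
    refine integral_congr_ae ?_
    filter_upwards [huK t ht] with x hx
    rw [clamp_of_mem hx]
  have hΦc : ContinuousOn (fun t => Phi Ω r (u t)) (Icc 0 T) :=
    ((continuous_integral_comp hrc hCr).comp_continuousOn hu.continuousOn).congr hΦ
  obtain ⟨J, hJL, hJw, hweak⟩ := hu.weak_form
  -- `Aj` holds the fluxes `D(u) ∂_j u` and `Bj` the vectors `∇²r(u) ∂_j u`. The `clamp` inside the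
  -- coefficients makes them bounded and continuous on the whole plane without changing them along
  -- the solution.
  set Aj : ℝ → Fin 2 → X0 Ω := fun t j => mulLp hDc hCD (u t) (J t j) with hAj
  set Bj : ℝ → Fin 2 → X0 Ω := fun t j => mulLp hHc hCH (u t) (J t j) with hBj
  -- Extension by zero places both in `L²` of the whole time line, where they can be translated.
  set A : ℝ → PiLp 2 (fun _ : Fin 2 => X0 Ω) :=
    (Ioc 0 T).indicator fun t => WithLp.toLp 2 (Aj t) with hA
  set B : ℝ → PiLp 2 (fun _ : Fin 2 => X0 Ω) :=
    (Ioc 0 T).indicator fun t => WithLp.toLp 2 (Bj t) with hB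
  have hAL : MemLp A 2 := (memLp_indicator_iff_restrict measurableSet_Ioc).2
    (MemLp.of_eval_piLp fun j => memLp_mulLp_of_continuousOn hu.continuousOn (hJL j) hDc hCD)
  have hBL : MemLp B 2 := (memLp_indicator_iff_restrict measurableSet_Ioc).2
    (MemLp.of_eval_piLp fun j => memLp_mulLp_of_continuousOn hu.continuousOn (hJL j) hHc hCH)
  have hAae : ∀ t ∈ Ioc 0 T, ∀ j, ∀ᵐ x ∂(volume.restrict Ω),
      Aj t j x = Matrix.toEuclideanCLM (n := Fin 2) (𝕜 := ℝ) (D (u t x)) (J t j x) := by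
    intro t ht j
    filter_upwards [coeFn_mulLp hDc hCD (u t) (J t j), huK t ⟨ht.1.le, ht.2⟩] with x h1 h2
    rw [hAj]
    simp only
    rw [h1, clamp_of_mem h2]
  have hBae : ∀ t ∈ Ioc 0 T, ∀ j, ∀ᵐ x ∂(volume.restrict Ω),
      Bj t j x = fderivWithin ℝ (gradientWithin r K) K (u t x) (J t j x) := by
    intro t ht j
    filter_upwards [coeFn_mulLp hHc hCH (u t) (J t j), huK t ⟨ht.1.le, ht.2⟩] with x h1 h2
    rw [hBj]
    simp only
    rw [h1, clamp_of_mem h2]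
  have hform : ∀ (Jw : Fin 2 → X0 Ω), ∀ s ∈ Ioc 0 T,
      diffusionForm Ω D (u s) (J s) Jw = inner ℝ (WithLp.toLp 2 Jw) (A s) := by
    intro Jw s hs
    rw [diffusionForm_eq_sum_inner (hAae s hs), PiLp.inner_apply, hA, indicator_of_mem hs]
  have hformint : ∀ (Jw : Fin 2 → X0 Ω),
      IntegrableOn (fun s => diffusionForm Ω D (u s) (J s) Jw) (Ioc 0 T) := by
    intro Jw
    have : IntegrableOn A (Ioc 0 T) := (hAL.restrict _).integrable (by norm_num)
    exact IntegrableOn.congr_fun (this.const_inner (WithLp.toLp 2 Jw))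
      (fun s hs => (hform Jw s hs).symm) measurableSet_Ioc
  have hanti : AntitoneOn (fun t => Phi Ω r (u t)) (Icc 0 T) := by
    refine antitoneOn_of_sub_le_neg_integral_inner hAL hBL hT hΦc ?_ ?_
    · rw [ae_restrict_iff' measurableSet_Ioc] at hJw
      filter_upwards [hJw] with σ hσJ hσ h hh
      have hσI : σ ∈ Icc 0 T := ⟨hσ.1.le, hσ.2⟩
      have hσh : σ - h ∈ Icc 0 T := ⟨by linarith [hh.2], by linarith [hh.1, hσ.2]⟩
      set w : X0 Ω := (memLp_comp hGc hCG (u σ) 2).toLp _ with hwdef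
      have hw : ∀ᵐ x ∂(volume.restrict Ω), w x = gradientWithin r K (u σ x) := by
        filter_upwards [(memLp_comp hGc hCG (u σ) 2).coeFn_toLp, huK σ hσI] with x h1 h2
        rw [h1, clamp_of_mem h2]
      have hwJ : HasWeakJacobian Ω w (Bj σ) :=
        hasWeakJacobian_comp hΩ_open hΩ_bdd (hσJ hσ) hKconv hKc (hKi.mono interior_subset) hKd
          (huK σ hσI) hGd hw (hBae σ hσ)
      refine (Phi_sub_le_inner hr_smooth hr_convex (huK σ hσI) (huK _ hσh) (hrint σ hσI)
        (hrint _ hσh) hw).trans (le_of_eq ?_)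
      -- Both instances use the same test function, so their difference is the equation integrated
      -- over `[σ - h, σ]`.
      have e1 := hweak w (Bj σ) hwJ σ hσI
      have e2 := hweak w (Bj σ) hwJ (σ - h) hσh
      have hi : ∀ a ∈ Icc 0 T, IntervalIntegrable
          (fun s => diffusionForm Ω D (u s) (J s) (Bj σ)) volume 0 a := fun a ha =>
        (intervalIntegrable_iff_integrableOn_Ioc_of_le ha.1).2
          ((hformint _).mono_set (Ioc_subset_Ioc_right ha.2))
      have e3 := intervalIntegral.integral_interval_sub_left (hi σ hσI) (hi _ hσh)
      have e4 : ∫ s in (σ - h)..σ, diffusionForm Ω D (u s) (J s) (Bj σ) =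
          ∫ s in (σ - h)..σ, inner ℝ (B σ) (A s) := by
        have hle : σ - h ≤ σ := by linarith [hh.1]
        rw [intervalIntegral.integral_of_le hle, intervalIntegral.integral_of_le hle]
        refine setIntegral_congr_fun measurableSet_Ioc fun s hs => ?_
        rw [hform _ s ⟨hσh.1.trans_lt hs.1, hs.2.trans hσ.2⟩, hB, indicator_of_mem hσ]
      rw [inner_sub_left]
      linarith
    · refine Filter.Eventually.of_forall fun σ hσ => ?_
      rw [hA, hB, indicator_of_mem hσ, indicator_of_mem hσ, PiLp.inner_apply]
      refine Finset.sum_nonneg fun j _ => ?_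
      rw [L2.inner_def]
      refine integral_nonneg_of_ae ?_
      filter_upwards [hAae σ hσ j, hBae σ hσ j, hcomm σ hσ] with x h1 h2 h3
      rw [h1, h2]
      exact inner_fderivWithin_gradientWithin_mulVec_nonneg hKd hKcl hr_smooth hr_convex h3.1
        (hD.dotProduct_mulVec_nonneg _) h3.2 _
  refine ⟨hrint, hΦc, hanti, fun t ht => ?_⟩
  -- Constants have zero Jacobian, so the diffusion term drops out and mass is conserved.
  have hmean : ∫ x in Ω, u t x = ∫ x in Ω, u₀ x := by
    refine integral_eq_of_forall_inner_const fun c => ?_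
    have e := hweak _ 0 (hasWeakJacobian_const c) t ht
    have h0 : ∫ s in (0 : ℝ)..t, diffusionForm Ω D (u s) (J s) 0 = 0 := by
      rw [intervalIntegral.integral_of_le ht.1]
      refine setIntegral_eq_zero_of_forall_eq_zero fun s hs => ?_
      rw [hform 0 s ⟨hs.1, hs.2.trans ht.2⟩, WithLp.toLp_zero, inner_zero_left]
    linarith
  have hmean' : mean u₀ = ⨍ x in Ω, u t x := by
    rw [mean_eq_average, setAverage_eq, setAverage_eq, hmean]
  rw [hmean']
  exact Phi_average_le (hΩ_open.measure_pos volume hΩ_conn.nonempty).ne' hKc.isClosed hr_convex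
    hr_smooth.continuousOn (huK t ht) (hrint t ht)
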